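/- Let $(E,\mathcal E)$ be a measurable space with countably generated $\sigma$-field and let $V:E\to(0,+\infty)$ be measurable. Let $L^\infty(V)$ be the Banach space of measurable functions $f:E\to\mathbb C$ with $\|f\|_V:=\sup_{x\in E}|f(x)|/V(x)<\infty$. For a measurable set $F\subset E$, write $L^\infty(V_{|F})$ for the same space built on $F$ with the weight $V_{|F}$. Inequalities between functions are pointwise; $f\ge 0$ means that all the values of $f$ are nonnegative reals. Let $P$ be a (nonnegative) kernel on $E$ such that $\|PV\|_V<\infty$. We also write $P$ for the bounded operator $Pf(x)=\int_E f(y)\,P(x,dy)$ that it induces on $L^\infty(V)$. For a bounded operator $Q$ on a complex Banach space, $r(Q)$ denotes its spectral radius, and $$r_{ess}(Q):=\lim_{n\to\infty}\inf\{\|Q^n-K\|^{1/n} : K \text{ a compact operator}\}.$$ The operator $Q$ is called quasi-compact if $r_{ess}(Q)<r(Q)$. For a measurable set $E_K\subset E$, consider the following conditions. * (H1) with constant $\theta_1$: $\theta_1\in(0,r(P))$ and $PV(x)\le\theta_1V(x)$ for all $x\in E\setminus E_K$. * (H2) with constant $\theta$: $\theta\in(0,r(P))$ and there is a positive compact operator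 $K$ on $L^\infty(V)$ such that $0\le Pf(x)\le Kf(x)+\theta V(x)\|f\|_V$ for all $x\in E_K$ and all $f\in L^\infty(V)$ with $f\ge0$. **Corollary.** Let $E_K\subset E$ be measurable. Assume that there are $\theta_4\in[0,r(P))$ and $A>0$ such that $$\theta_2:=\sup_{x\in E_K}\frac{1}{V(x)}P(V\mathbf 1_{V>A})(x)+\theta_4<r(P)$$ (the supremum being $0$ if $E_K=\emptyset$), and that there is a compact linear operator $K_A:L^\infty(V_{|\{V\le A\}})\to L^\infty(V_{|E_K})$ such that $$0\le P(f\mathbf 1_{V\le A})(x)\le K_Af(x)+\theta_4V(x)\|f\|_V\quad\text{for all }x\in E_K\text{ and all }f\in L^\infty(V_{|\{V\le A\}})\text{ with }f\ge0,$$ where $f\mathbf 1_{V\le A}$ is the extension of $f$ by $0$. Then (H2) holds for some constant, and it holds with the constant $\theta_2$ if $\theta_2>0$. If in addition (H1) holds with a constant $\theta_1$, then $P$ is quasi-compact on $L^\infty(V)$ and $r_{ess}(P)\le\max(\theta_1,\theta_2)$. -/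

import Mathlib

open MeasureTheory ProbabilityTheory Filter
open scoped NNReal ENNReal ComplexOrder

/-- A weight: a measurable function `V : X → (0, +∞)`. -/
structure Weight (X : Type*) [MeasurableSpace X] where
  toFun : X → ℝ
  measurable' : Measurable toFun
  pos' : ∀ x, 0 < toFun x

namespace Weight

variable {X : Type*} [MeasurableSpace X]

instance : CoeFun (Weight X) (fun _ => X → ℝ) := ⟨Weight.toFun⟩

theorem pos (V : Weight X) (x : X) : 0 < V x := V.pos' x

theorem measurable (V : Weight X) : Measurable V := V.measurable'

/-- The restriction `V|_S`, a weight on the measurable subspace `S`. -/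
def restrict (V : Weight X) (S : Set X) : Weight S where
  toFun x := V x
  measurable' := V.measurable.comp measurable_subtype_coe
  pos' x := V.pos x

/-- The measurable functions `f : X → ℂ` with `|f| ≤ C V` for some constant `C`. -/
def linftySubmodule (V : Weight X) : Submodule ℂ (X → ℂ) where
  carrier := {f | Measurable f ∧ ∃ C : ℝ, ∀ x, ‖f x‖ ≤ C * V x}
  add_mem' := by
    rintro f g ⟨hf, C, hC⟩ ⟨hg, D, hD⟩
    refine ⟨hf.add hg, C + D, fun x => ?_⟩
    calc ‖f x + g x‖ ≤ ‖f x‖ + ‖g x‖ := norm_add_le _ _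
      _ ≤ (C + D) * V x := by linarith [hC x, hD x]
  zero_mem' := ⟨measurable_const, 0, fun x => by simp⟩
  smul_mem' := by
    rintro c f ⟨hf, C, hC⟩
    refine ⟨hf.const_smul c, ‖c‖ * C, fun x => ?_⟩
    calc ‖c • f x‖ = ‖c‖ * ‖f x‖ := norm_smul _ _
      _ ≤ ‖c‖ * (C * V x) := mul_le_mul_of_nonneg_left (hC x) (norm_nonneg c)
      _ = ‖c‖ * C * V x := by ring

end Weight

/-- The weighted space `L^∞(V)` of complex-valued measurable functions (everywhere defined,
not classes modulo null sets). Its topology is the one of the norm `‖·‖_V` below. -/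
def Linfty {X : Type*} [MeasurableSpace X] (V : Weight X) : Type _ := V.linftySubmodule

namespace Linfty

variable {X : Type*} [MeasurableSpace X] {V : Weight X}

noncomputable instance : AddCommGroup (Linfty V) :=
  inferInstanceAs (AddCommGroup V.linftySubmodule)

noncomputable instance : Module ℂ (Linfty V) :=
  inferInstanceAs (Module ℂ V.linftySubmodule)

instance : CoeFun (Linfty V) (fun _ => X → ℂ) := ⟨fun f => f.1⟩

theorem measurable (f : Linfty V) : Measurable (f : X → ℂ) := f.2.1

@[ext]
theorem ext {f g : Linfty V} (h : ∀ x, f x = g x) : f = g := Subtype.ext (funext h)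

@[simp]
theorem add_apply (f g : Linfty V) (x : X) : (f + g) x = f x + g x := rfl

@[simp]
theorem smul_apply (c : ℂ) (f : Linfty V) (x : X) : (c • f) x = c * f x := rfl

@[simp]
theorem zero_apply (x : X) : (0 : Linfty V) x = 0 := rfl

/-- The weighted supremum norm `‖f‖_V = sup_x |f x| / V x`. -/
noncomputable instance : Norm (Linfty V) := ⟨fun f => ⨆ x, ‖f x‖ / V x⟩

theorem norm_def (f : Linfty V) : ‖f‖ = ⨆ x, ‖f x‖ / V x := rfl

theorem bddAbove (f : Linfty V) : BddAbove (Set.range fun x => ‖f x‖ / V x) := by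
  obtain ⟨C, hC⟩ := f.2.2
  refine ⟨C, ?_⟩
  rintro _ ⟨x, rfl⟩
  exact (div_le_iff₀ (V.pos x)).2 (hC x)

theorem norm_apply_le (f : Linfty V) (x : X) : ‖f x‖ ≤ ‖f‖ * V x :=
  (div_le_iff₀ (V.pos x)).1 (le_ciSup f.bddAbove x)

theorem norm_nonneg' (f : Linfty V) : 0 ≤ ‖f‖ :=
  Real.iSup_nonneg fun x => div_nonneg (norm_nonneg _) (V.pos x).le

theorem norm_le_of {f : Linfty V} {C : ℝ} (hC : 0 ≤ C) (h : ∀ x, ‖f x‖ ≤ C * V x) :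
    ‖f‖ ≤ C :=
  Real.iSup_le (fun x => (div_le_iff₀ (V.pos x)).2 (h x)) hC

theorem normedSpaceCore : NormedSpace.Core ℂ (Linfty V) where
  norm_nonneg := norm_nonneg'
  norm_smul c f := by
    rw [norm_def, norm_def, Real.mul_iSup_of_nonneg (norm_nonneg c)]
    congr 1
    funext x
    rw [smul_apply, norm_mul, mul_div_assoc]
  norm_triangle f g := by
    refine norm_le_of (add_nonneg f.norm_nonneg' g.norm_nonneg') fun x => ?_
    calc ‖f x + g x‖ ≤ ‖f x‖ + ‖g x‖ := norm_add_le _ _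
      _ ≤ (‖f‖ + ‖g‖) * V x := by linarith [f.norm_apply_le x, g.norm_apply_le x]
  norm_eq_zero_iff f := by
    constructor
    · intro h
      ext x
      have := f.norm_apply_le x
      rw [h, zero_mul] at this
      exact norm_le_zero_iff.1 this
    · rintro rfl
      simp [norm_def]

noncomputable instance : NormedAddCommGroup (Linfty V) :=
  NormedAddCommGroup.ofCore normedSpaceCore

noncomputable instance : NormedSpace ℂ (Linfty V) :=
  NormedSpace.ofCore normedSpaceCore

/-- `f ≥ 0`: every value of `f` is a nonnegative real number. -/
def IsNonneg (f : Linfty V) : Prop := ∀ x, 0 ≤ f x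

/-- The function `f 1_S ∈ L^∞(V)`, for `f ∈ L^∞(V|_S)`: the extension of `f` by `0`. -/
noncomputable def extendZero {S : Set X} (hS : MeasurableSet S)
    (f : Linfty (V.restrict S)) : Linfty V :=
  ⟨Function.extend Subtype.val f 0, by
    refine ⟨(MeasurableEmbedding.subtype_coe hS).measurable_extend f.measurable
      measurable_const, ‖f‖, fun x => ?_⟩
    by_cases hx : x ∈ S
    · have h := Subtype.val_injective.extend_apply (f : S → ℂ) 0 ⟨x, hx⟩
      simp only at h
      rw [h]
      exact f.norm_apply_le ⟨x, hx⟩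
    · rw [Function.extend_apply' _ _ _ (by rintro ⟨y, rfl⟩; exact hx y.2)]
      simpa using mul_nonneg f.norm_nonneg' (V.pos x).le⟩

end Linfty

section Operators

variable {B : Type*} [NormedAddCommGroup B] [NormedSpace ℂ B]

/-- `r_ess(Q) = lim_n inf {‖Q^n - K‖^{1/n} : K compact}`. The limit always exists by
submultiplicativity; it is written as an upper limit, which is meaningful unconditionally. -/
noncomputable def essentialSpectralRadius (Q : B →L[ℂ] B) : ℝ≥0∞ :=
  limsup (fun n : ℕ => ⨅ K : {K : B →L[ℂ] B // IsCompactOperator K},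
    ‖Q ^ n - K.1‖ₑ ^ (1 / (n : ℝ))) atTop

/-- `Q` is quasi-compact if `r_ess(Q) < r(Q)`. -/
def IsQuasiCompact (Q : B →L[ℂ] B) : Prop :=
  essentialSpectralRadius Q < spectralRadius ℂ Q

end Operators

section Kernels

variable {E : Type*} [MeasurableSpace E]

/-- A linear operator on `L^∞(V)` is positive if it maps nonnegative functions to nonnegative
functions. -/
def IsPositiveOperator {V : Weight E} (K : Linfty V →L[ℂ] Linfty V) : Prop :=
  ∀ f : Linfty V, f.IsNonneg → (K f).IsNonneg

/-- `P` is a kernel from `E` to `L^∞(V)`: `‖PV‖_V < ∞`. -/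
def IsKernelInto (V : Weight E) (P : Kernel E E) : Prop :=
  ∃ C : ℝ≥0, ∀ x, ∫⁻ y, ENNReal.ofReal (V y) ∂(P x) ≤ C * ENNReal.ofReal (V x)

theorem IsKernelInto.integrable {V : Weight E} {P : Kernel E E} (hP : IsKernelInto V P)
    (x : E) : Integrable V (P x) := by
  obtain ⟨C, hC⟩ := hP
  refine ⟨V.measurable.aestronglyMeasurable, ?_⟩
  rw [hasFiniteIntegral_iff_ofReal (Eventually.of_forall fun y => (V.pos y).le)]
  exact (hC x).trans_lt (ENNReal.mul_lt_top ENNReal.coe_lt_top ENNReal.ofReal_lt_top)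

theorem IsKernelInto.integrable_apply {V : Weight E} {P : Kernel E E} (hP : IsKernelInto V P)
    (f : Linfty V) (x : E) : Integrable f (P x) :=
  ((hP.integrable x).const_mul ‖f‖).mono' f.measurable.aestronglyMeasurable
    (Eventually.of_forall fun y => f.norm_apply_le y)

theorem IsKernelInto.measurable_integral {V : Weight E} {P : Kernel E E}
    (hP : IsKernelInto V P) (f : Linfty V) : Measurable fun x => ∫ y, f y ∂(P x) := by
  have key : ∀ g : E → ℝ, Measurable g → (∀ x, Integrable g (P x)) →
      Measurable fun x => ∫ y, g y ∂(P x) := by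
    intro g hg hi
    have h : (fun x => ∫ y, g y ∂(P x)) = fun x =>
        (∫⁻ y, ENNReal.ofReal (g y) ∂(P x)).toReal
          - (∫⁻ y, ENNReal.ofReal (-g y) ∂(P x)).toReal :=
      funext fun x => integral_eq_lintegral_pos_part_sub_lintegral_neg_part (hi x)
    rw [h]
    exact (hg.ennreal_ofReal.lintegral_kernel.ennreal_toReal).sub
      (hg.neg.ennreal_ofReal.lintegral_kernel.ennreal_toReal)
  have h : (fun x => ∫ y, f y ∂(P x)) = fun x =>
      ((∫ y, (f y).re ∂(P x) : ℝ) : ℂ) + ((∫ y, (f y).im ∂(P x) : ℝ) : ℂ) * Complex.I :=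
    funext fun x => (integral_re_add_im (𝕜 := ℂ) (hP.integrable_apply f x)).symm
  rw [h]
  have h1 := key (fun y => (f y).re) (Complex.measurable_re.comp f.measurable)
    (fun x => (hP.integrable_apply f x).re)
  have h2 := key (fun y => (f y).im) (Complex.measurable_im.comp f.measurable)
    (fun x => (hP.integrable_apply f x).im)
  exact (Complex.measurable_ofReal.comp h1).add
    ((Complex.measurable_ofReal.comp h2).mul_const _)

theorem IsKernelInto.exists_bound {V : Weight E} {P : Kernel E E} (hP : IsKernelInto V P) :
    ∃ C : ℝ, 0 ≤ C ∧ ∀ (f : Linfty V) (x : E), ‖∫ y, f y ∂(P x)‖ ≤ C * ‖f‖ * V x := by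
  have hint := hP.integrable
  obtain ⟨C, hC⟩ := hP
  refine ⟨C, C.2, fun f x => ?_⟩
  have h1 : ∫ y, V y ∂(P x) ≤ C * V x := by
    rw [integral_eq_lintegral_of_nonneg_ae (Eventually.of_forall fun y => (V.pos y).le)
      V.measurable.aestronglyMeasurable]
    refine ENNReal.toReal_le_of_le_ofReal (mul_nonneg C.coe_nonneg (V.pos x).le) ?_
    rw [ENNReal.ofReal_mul C.coe_nonneg, ENNReal.ofReal_coe_nnreal]
    exact hC x
  calc ‖∫ y, f y ∂(P x)‖ ≤ ∫ y, ‖f‖ * V y ∂(P x) :=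
        norm_integral_le_of_norm_le ((hint x).const_mul _)
          (Eventually.of_forall fun y => f.norm_apply_le y)
    _ = ‖f‖ * ∫ y, V y ∂(P x) := integral_const_mul _ _
    _ ≤ ‖f‖ * (C * V x) := mul_le_mul_of_nonneg_left h1 f.norm_nonneg'
    _ = C * ‖f‖ * V x := by ring

/-- The bounded operator `f ↦ Pf`, `Pf(x) = ∫ f(y) P(x,dy)`, induced on `L^∞(V)`. -/
noncomputable def kernelOp (V : Weight E) (P : Kernel E E) (hP : IsKernelInto V P) :
    Linfty V →L[ℂ] Linfty V :=
  LinearMap.mkContinuousOfExistsBound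
    { toFun := fun f => ⟨fun x => ∫ y, f y ∂(P x), hP.measurable_integral f, by
        obtain ⟨C, -, hC⟩ := hP.exists_bound
        exact ⟨C * ‖f‖, hC f⟩⟩
      map_add' := fun f g => Linfty.ext fun x =>
        integral_add (hP.integrable_apply f x) (hP.integrable_apply g x)
      map_smul' := fun c f => Linfty.ext fun x =>
        integral_const_mul c (fun y => f y) }
    (by
      obtain ⟨C, hC0, hC⟩ := hP.exists_bound
      exact ⟨C, fun f => Linfty.norm_le_of (mul_nonneg hC0 f.norm_nonneg') (hC f)⟩)

/-- Condition (H1), global Lyapunov criterion, for the set `E_K` with the constant `θ₁`. -/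
def GlobalLyapunov (V : Weight E) (P : Kernel E E) (hP : IsKernelInto V P) (E_K : Set E)
    (θ₁ : ℝ≥0) : Prop :=
  0 < θ₁ ∧ (θ₁ : ℝ≥0∞) < spectralRadius ℂ (kernelOp V P hP) ∧
    ∀ x, x ∉ E_K → ∫⁻ y, ENNReal.ofReal (V y) ∂(P x) ≤ θ₁ * ENNReal.ofReal (V x)

/-- Condition (H2), local domination, for the set `E_K` with the constant `θ₂`. -/
def LocalDomination (V : Weight E) (P : Kernel E E) (hP : IsKernelInto V P) (E_K : Set E)
    (θ₂ : ℝ≥0) : Prop :=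
  0 < θ₂ ∧ (θ₂ : ℝ≥0∞) < spectralRadius ℂ (kernelOp V P hP) ∧
    ∃ K : Linfty V →L[ℂ] Linfty V, IsPositiveOperator K ∧ IsCompactOperator K ∧
      ∀ x ∈ E_K, ∀ f : Linfty V, f.IsNonneg →
        0 ≤ kernelOp V P hP f x ∧
          kernelOp V P hP f x ≤ K f x + ((θ₂ * V x * ‖f‖ : ℝ) : ℂ)

/-- The sublevel set `{V ≤ A}`. -/
def Weight.sublevel (V : Weight E) (A : ℝ) : Set E := {x | V x ≤ A}

theorem Weight.measurableSet_sublevel (V : Weight E) (A : ℝ) :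
    MeasurableSet (V.sublevel A) :=
  measurableSet_le V.measurable measurable_const

/-- `sup_{x ∈ E_K} P(V 1_{V > A})(x) / V(x)`, in `[0, ∞]`. -/
noncomputable def tailBound (V : Weight E) (P : Kernel E E) (E_K : Set E) (A : ℝ) : ℝ≥0∞ :=
  ⨆ x ∈ E_K, (∫⁻ y in {y | A < V y}, ENNReal.ofReal (V y) ∂(P x)) / ENNReal.ofReal (V x)

/-- `K_A` dominates `P` restricted to functions on `{V ≤ A}`, on the set `E_K`, up to `θ₄`. -/
def SublevelDomination (V : Weight E) (P : Kernel E E) (hP : IsKernelInto V P) (E_K : Set E)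
    (A : ℝ) (θ₄ : ℝ≥0)
    (K_A : Linfty (V.restrict (V.sublevel A)) →L[ℂ] Linfty (V.restrict E_K)) : Prop :=
  ∀ (x : E_K) (f : Linfty (V.restrict (V.sublevel A))), f.IsNonneg →
    0 ≤ kernelOp V P hP (f.extendZero (V.measurableSet_sublevel A)) x ∧
      kernelOp V P hP (f.extendZero (V.measurableSet_sublevel A)) x ≤
        K_A f x + ((θ₄ * V x * ‖f‖ : ℝ) : ℂ)

end Kernels

/-!
The proof has two independent parts.

*Domination by a positive compact operator.* The operator `K_A`, composed with restriction and
extension by zero, gives a compact operator `K` on `L^∞(V)` which need not be positive. It is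
replaced by `K⁺`, where `K⁺ f (x) = sup {Re K g (x) : 0 ≤ g ≤ f}` for `f ≥ 0`. Since `K` is compact, the
functionals `f ↦ K f (x) / V x` form a norm totally bounded family, finitely approximable in a
measurable way (`Linfty.exists_measurable_finite_approx`), and the passage to the positive part of a
functional is Lipschitz in norm. Hence `K⁺` is a norm limit of finite-rank operators, which yields
both the measurability of `K⁺ f` and the compactness of `K⁺`
(`Linfty.exists_positive_compact_majorant`).

*Essential spectral radius.* Suppose `P f ≤ K f + θ V ‖f‖` for `f ≥ 0`, with `K` positive and
compact, and let `Q(x, dy) = V(x)⁻¹ P(x, dy) V(y)`. As a function of the set `s`, `K (V 1_s)(x) / V x` is a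
finitely additive set function. If `ν` is the measure associated with such a set function `φ` by the
outer measure construction, an inequality `μ ≤ φ + c` with `μ` a measure passes to `μ ≤ ν + c`
(`exists_measure_le_of_additive`). By total boundedness, finitely many of these measures suffice:
there is a finite measure `m` with `Q x ≤ m + θ + ε` for all `x`
(`exists_measure_normalizedKernel_le`). As the σ-field is countably generated, `Q` has a jointly
measurable density with respect to `m`. Truncating it splits `Q = S + R` with `S x ≤ M m` and with
`R` of total mass at most `θ + 2ε` (`exists_section_le_smul`).

The operator induced by `S` turns bounded sequences into sequences with a pointwise convergent
subsequence (weak-* compactness in the dual of `L¹(m)`) and bounded pointwise convergence into norm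
convergence (dominated convergence under `m`), while the powers of the operator induced by `R`
preserve bounded pointwise convergence. Therefore every product `S R^k S` is compact
(`isCompactOperator_weightedOp_mul`). Modulo compact operators, only the terms of `(S + R)^n` with
at most one factor `S` remain, of total norm `O(n (θ + 2ε)^n)`, so the essential spectral radius is at
most `θ + 2ε` (`essentialSpectralRadius_add_le`).
-/

/-! ### Countably additive parts, essential spectral radius and sequential compactness -/

/-- The countably additive part `ν` of a finitely additive set function `φ`, obtained from the outer
measure `s ↦ inf {∑ φ (t n) : s ⊆ ⋃ t n}`: domination of a measure by `φ` up to a constant passes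
to `ν`. -/
theorem exists_measure_le_of_additive {X : Type*} [MeasurableSpace X] (φ : Set X → ℝ≥0∞)
    (hφ0 : φ ∅ = 0)
    (hφ : ∀ s t, MeasurableSet s → MeasurableSet t → Disjoint s t → φ (s ∪ t) = φ s + φ t) :
    ∃ ν : Measure X, (∀ s, MeasurableSet s → ν s ≤ φ s) ∧
      ∀ (μ : Measure X) (c : ℝ≥0∞), (∀ s, MeasurableSet s → μ s ≤ φ s + c) →
        ∀ s, MeasurableSet s → μ s ≤ ν s + c := by
  classical
  -- covers by nonmeasurable sets are excluded by giving them infinite weight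
  set m : Set X → ℝ≥0∞ := fun s => if MeasurableSet s then φ s else ∞ with hm
  have hm0 : m ∅ = 0 := by simp [hm, hφ0]
  have hmeas : ∀ s, MeasurableSet s → m s = φ s := fun s hs => by simp [hm, hs]
  have hcar : ‹MeasurableSpace X› ≤ (OuterMeasure.ofFunction m hm0).caratheodory := by
    intro s hs
    refine OuterMeasure.ofFunction_caratheodory fun t => ?_
    by_cases ht : MeasurableSet t
    · rw [hmeas _ (ht.inter hs), hmeas _ (ht.diff hs), hmeas _ ht,
        ← hφ _ _ (ht.inter hs) (ht.diff hs) Set.disjoint_sdiff_inter.symm, Set.inter_union_sdiff]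
    · simp [hm, ht]
  have hsub : ∀ s t, MeasurableSet s → MeasurableSet t → φ (s ∪ t) ≤ φ s + φ t := by
    intro s t hs ht
    have h1 : φ (s ∪ t) = φ s + φ (t \ s) := by
      rw [← hφ _ _ hs (ht.diff hs) Set.disjoint_sdiff_right, Set.union_sdiff_self]
    have h2 : φ t = φ (t ∩ s) + φ (t \ s) := by
      rw [← hφ _ _ (ht.inter hs) (ht.diff hs) Set.disjoint_sdiff_inter.symm,
        Set.inter_union_sdiff]
    rw [h1, h2]
    gcongr
    exact le_add_self
  refine ⟨(OuterMeasure.ofFunction m hm0).toMeasure hcar, fun s hs => ?_, fun μ c h s hs => ?_⟩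
  · rw [toMeasure_apply _ _ hs]
    exact (OuterMeasure.ofFunction_le s).trans (hmeas s hs).le
  · rw [toMeasure_apply _ _ hs, OuterMeasure.ofFunction_apply]
    simp only [ENNReal.iInf_add]
    refine le_iInf fun t => le_iInf fun hst => ?_
    by_cases ht : ∀ n, MeasurableSet (t n)
    · have hfin : ∀ n, φ (Set.accumulate t n) ≤ ∑ i ∈ Finset.range (n + 1), φ (t i) := by
        intro n
        induction n with
        | zero => simp [Set.accumulate]
        | succ n ih =>
          rw [Set.accumulate_succ, Finset.sum_range_succ]
          have hacc : MeasurableSet (Set.accumulate t n) :=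
            MeasurableSet.biUnion (Set.to_countable _) fun i _ => ht i
          exact (hsub _ _ hacc (ht _)).trans (by gcongr)
      have hU : μ (⋃ n, t n) ≤ ∑' n, m (t n) + c := by
        rw [← Set.iUnion_accumulate, Set.monotone_accumulate.measure_iUnion]
        refine iSup_le fun n => ?_
        refine (h _ (MeasurableSet.biUnion (Set.to_countable _) fun i _ => ht i)).trans ?_
        gcongr
        refine (hfin n).trans ?_
        simp only [hmeas _ (ht _)]
        exact ENNReal.sum_le_tsum _
      exact (measure_mono hst).trans hU
    · push Not at ht
      obtain ⟨n, hn⟩ := ht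
      have : ∑' n, m (t n) = ∞ := ENNReal.tsum_eq_top_of_eq_top ⟨n, by simp [hm, hn]⟩
      simp [this]

section
variable {B : Type*} [NormedAddCommGroup B] [NormedSpace ℂ B]

/-- If every `S R^k S` is compact, then `(S + R)^n` equals, modulo a compact operator, the sum of
the terms with no factor `S` (namely `R^n`) and with one factor `S` (namely `L`). -/
theorem exists_pow_eq_add_compact (S R : B →L[ℂ] B) {ρ : ℝ} (hρ : 0 < ρ) (hR : ‖R‖ ≤ ρ)
    (hS : ∀ k : ℕ, IsCompactOperator (S * R ^ k * S)) (n : ℕ) :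
    ∃ L C : B →L[ℂ] B, (S + R) ^ n = R ^ n + L + C ∧ IsCompactOperator C ∧
      (∀ k : ℕ, IsCompactOperator (L * R ^ k * S)) ∧ ‖L‖ ≤ n * (‖S‖ / ρ) * ρ ^ n := by
  induction n with
  | zero =>
    refine ⟨0, 0, by simp, isCompactOperator_zero, fun k => ?_, by simp⟩
    simpa using isCompactOperator_zero
  | succ n ih =>
    obtain ⟨L, C, h, hC, hL, hn⟩ := ih
    refine ⟨L * R + R ^ n * S, L * S + C * (S + R), ?_, ?_, fun k => ?_, ?_⟩
    · rw [pow_succ, h, pow_succ]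
      noncomm_ring
    · have h0 := hL 0
      rw [pow_zero, mul_one] at h0
      exact h0.add (hC.comp_clm (S + R))
    · have h1 := hL (k + 1)
      have h2 := (hS k).clm_comp (R ^ n)
      have h3 := h1.add h2
      have e : (L * R + R ^ n * S) * R ^ k * S
          = L * R ^ (k + 1) * S + R ^ n * (S * R ^ k * S) := by
        rw [pow_succ']
        noncomm_ring
      rw [e]
      exact h3
    · have hRn : ‖R ^ n * S‖ ≤ ρ ^ n * ‖S‖ := by
        refine (norm_mul_le _ _).trans ?_
        -- `‖1‖ ≤ 1` also holds on the zero space, where `‖1‖ = 0`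
        rcases Nat.eq_zero_or_pos n with rfl | hn0
        · simp only [pow_zero, one_mul]
          exact mul_le_of_le_one_left (norm_nonneg _) ContinuousLinearMap.norm_id_le
        · gcongr
          exact (norm_pow_le' R hn0).trans (by gcongr)
      calc ‖L * R + R ^ n * S‖ ≤ ‖L‖ * ‖R‖ + ρ ^ n * ‖S‖ :=
            (norm_add_le _ _).trans (add_le_add (norm_mul_le _ _) hRn)
        _ ≤ (n * (‖S‖ / ρ) * ρ ^ n) * ρ + ρ ^ n * ‖S‖ := by gcongr
        _ = ((n + 1 : ℕ) : ℝ) * (‖S‖ / ρ) * ρ ^ (n + 1) := by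
            push_cast
            rw [pow_succ]
            field_simp

theorem essentialSpectralRadius_add_le (S R : B →L[ℂ] B) {ρ : ℝ≥0} (hρ : 0 < ρ) (hR : ‖R‖ ≤ ρ)
    (hS : ∀ k : ℕ, IsCompactOperator (S * R ^ k * S)) :
    essentialSpectralRadius (S + R) ≤ ρ := by
  refine ENNReal.le_of_forall_pos_le_add fun δ hδ _ => ?_
  rw [← ENNReal.coe_add]
  set ρ' : ℝ≥0 := ρ + δ with hρ'
  have hlt : ρ < ρ' := lt_add_of_pos_right _ hδ
  have hρ'0 : 0 < ρ' := hρ.trans hlt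
  set r : ℝ := ρ / ρ' with hr
  have hr0 : 0 ≤ r := by positivity
  have hr1 : r < 1 := by
    rw [hr, div_lt_one (by exact_mod_cast hρ'0)]
    exact_mod_cast hlt
  -- polynomial growth is absorbed by enlarging the base of the geometric term
  have hlim : Tendsto (fun n : ℕ => r ^ n + (‖S‖ / ρ) * (n * r ^ n)) atTop
      (nhds (0 + ‖S‖ / ρ * 0)) :=
    (tendsto_pow_atTop_nhds_zero_of_lt_one hr0 hr1).add
      ((tendsto_self_mul_const_pow_of_lt_one hr0 hr1).const_mul _)
  have hev : ∀ᶠ n : ℕ in atTop, r ^ n + (‖S‖ / ρ) * (n * r ^ n) < 1 :=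
    hlim.eventually (gt_mem_nhds (by simp))
  refine limsup_le_of_le (by isBoundedDefault) ?_
  filter_upwards [hev, eventually_gt_atTop 0] with n hn hn0
  obtain ⟨L, C, h, hC, -, hL⟩ := exists_pow_eq_add_compact S R (by exact_mod_cast hρ) hR hS n
  refine (iInf_le _ ⟨C, hC⟩).trans ?_
  have hnorm : ‖(S + R) ^ n - C‖ ≤ (ρ' : ℝ) ^ n := by
    have hρr : (ρ : ℝ) ^ n = r ^ n * ρ' ^ n := by
      rw [hr, div_pow]
      field_simp
    calc ‖(S + R) ^ n - C‖ = ‖R ^ n + L‖ := by rw [h, add_sub_cancel_right]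
      _ ≤ (ρ : ℝ) ^ n + n * (‖S‖ / ρ) * ρ ^ n := by
          refine (norm_add_le _ _).trans (add_le_add ?_ hL)
          exact (norm_pow_le' R hn0).trans (by gcongr)
      _ = (r ^ n + (‖S‖ / ρ) * (n * r ^ n)) * ρ' ^ n := by rw [hρr]; ring
      _ ≤ 1 * ρ' ^ n := by gcongr
      _ = _ := one_mul _
  have henorm : ‖(S + R) ^ n - C‖ₑ ≤ (ρ' : ℝ≥0∞) ^ n := by
    rw [enorm_eq_nnnorm, ← ENNReal.coe_pow, ENNReal.coe_le_coe]
    exact_mod_cast hnorm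
  calc ‖(S + R) ^ n - C‖ₑ ^ (1 / (n : ℝ)) ≤ ((ρ' : ℝ≥0∞) ^ n) ^ (1 / (n : ℝ)) := by gcongr
    _ = ρ' := by
        rw [← ENNReal.rpow_natCast, ← ENNReal.rpow_mul, mul_one_div_cancel (by positivity),
          ENNReal.rpow_one]

theorem isCompactOperator_of_exists_subseq_tendsto (T : B →L[ℂ] B)
    (h : ∀ f : ℕ → B, (∀ n, ‖f n‖ ≤ 1) →
      ∃ (g : B) (s : ℕ → ℕ), StrictMono s ∧ Tendsto (fun n => T (f (s n))) atTop (nhds g)) :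
    IsCompactOperator T := by
  refine (isCompactOperator_iff_isCompact_closure_image_closedBall (T : B →ₗ[ℂ] B) one_pos).2 ?_
  refine IsSeqCompact.isCompact fun y hy => ?_
  have happrox : ∀ n : ℕ, ∃ f : B, ‖f‖ ≤ 1 ∧ dist (y n) (T f) < 1 / ((n : ℝ) + 1) := by
    intro n
    obtain ⟨_, ⟨f, hf, rfl⟩, hd⟩ := Metric.mem_closure_iff.1 (hy n) (1 / ((n : ℝ) + 1))
      Nat.one_div_pos_of_nat
    exact ⟨f, by simpa using hf, hd⟩
  choose f hf hd using happrox
  obtain ⟨g, s, hs, hg⟩ := h f hf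
  refine ⟨g, ?_, s, hs, ?_⟩
  · refine mem_closure_of_tendsto hg (Eventually.of_forall fun n => ?_)
    exact ⟨f (s n), by simpa using hf (s n), rfl⟩
  · refine tendsto_iff_dist_tendsto_zero.2 ?_
    have h1 : Tendsto (fun n => 1 / (((s n : ℕ) : ℝ) + 1) + dist (T (f (s n))) g) atTop
        (nhds 0) := by
      simpa using (tendsto_one_div_add_atTop_nhds_zero_nat.comp hs.tendsto_atTop).add
        (tendsto_iff_dist_tendsto_zero.1 hg)
    refine squeeze_zero (fun _ => dist_nonneg) (fun n => ?_) h1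
    exact (dist_triangle _ (T (f (s n))) _).trans (add_le_add_left (hd (s n)).le _)
end

/-! ### The space `L^∞(V)` and finite approximation of compact operators -/

namespace Linfty
variable {X : Type*} [MeasurableSpace X] {V : Weight X}

/-- The element of `L^∞(V)` given by a measurable function bounded by a multiple of `V`. -/
def ofBound (f : X → ℂ) (hf : Measurable f) (C : ℝ) (h : ∀ x, ‖f x‖ ≤ C * V x) : Linfty V :=
  ⟨f, hf, C, h⟩

@[simp] theorem ofBound_apply (f : X → ℂ) (hf : Measurable f) (C : ℝ)
    (h : ∀ x, ‖f x‖ ≤ C * V x) (x : X) : (ofBound f hf C h : Linfty V) x = f x := rfl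

@[simp] theorem neg_apply (f : Linfty V) (x : X) : (-f) x = -f x := rfl

@[simp] theorem sub_apply (f g : Linfty V) (x : X) : (f - g) x = f x - g x := by
  rw [sub_eq_add_neg, add_apply, neg_apply, sub_eq_add_neg]

@[simp] theorem real_smul_apply (t : ℝ) (f : Linfty V) (x : X) : (t • f) x = (t : ℂ) * f x := by
  rw [← Complex.coe_smul, smul_apply]

/-- The continuous functional `f ↦ f x / V x`, of norm at most one. -/
noncomputable def normalizedEval (V : Weight X) (x : X) : Linfty V →L[ℂ] ℂ :=
  LinearMap.mkContinuous
    { toFun := fun f => f x / V x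
      map_add' := fun f g => by simp [add_div]
      map_smul' := fun c f => by simp [mul_div_assoc] } 1
    (fun f => by
      simp only [LinearMap.coe_mk, AddHom.coe_mk, norm_div, one_mul, Complex.norm_real,
        Real.norm_of_nonneg (V.pos x).le]
      exact (div_le_iff₀ (V.pos x)).2 (f.norm_apply_le x))

theorem normalizedEval_apply (x : X) (f : Linfty V) : normalizedEval V x f = f x / V x := rfl

theorem mul_normalizedEval (x : X) (f : Linfty V) : V x * normalizedEval V x f = f x := by
  rw [normalizedEval_apply, mul_div_cancel₀]
  exact_mod_cast (V.pos x).ne'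

theorem norm_normalizedEval_apply_le (x : X) (f : Linfty V) : ‖normalizedEval V x f‖ ≤ ‖f‖ := by
  refine ((normalizedEval V x).le_of_opNorm_le ?_ f).trans (one_mul _).le
  exact LinearMap.mkContinuous_norm_le _ zero_le_one _

instance : CompleteSpace (Linfty V) := by
  refine Metric.complete_of_cauchySeq_tendsto fun u hu => ?_
  have hpt : ∀ x, CauchySeq fun n => u n x := by
    intro x
    have h := (normalizedEval V x).uniformContinuous.comp_cauchySeq hu
    have h2 := ((ContinuousLinearMap.mul ℂ ℂ) (V x : ℂ)).uniformContinuous.comp_cauchySeq h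
    have e : (fun n => u n x) = _ := funext fun n => (mul_normalizedEval x (u n)).symm
    rw [e]
    exact h2
  choose f hf using fun x => cauchySeq_tendsto_of_complete (hpt x)
  obtain ⟨C, hC⟩ := hu.norm_bddAbove
  have hmeas : Measurable f :=
    measurable_of_tendsto_metrizable (fun n => (u n).measurable) (tendsto_pi_nhds.2 hf)
  have hb : ∀ x, ‖f x‖ ≤ C * V x := fun x => le_of_tendsto (hf x).norm
    (Eventually.of_forall fun n => ((u n).norm_apply_le x).trans
      (mul_le_mul_of_nonneg_right (hC ⟨n, rfl⟩) (V.pos x).le))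
  refine ⟨ofBound f hmeas C hb, Metric.tendsto_atTop.2 fun ε hε => ?_⟩
  obtain ⟨N, hN⟩ := Metric.cauchySeq_iff.1 hu (ε / 2) (half_pos hε)
  refine ⟨N, fun n hn => ?_⟩
  rw [dist_eq_norm]
  refine lt_of_le_of_lt (norm_le_of (half_pos hε).le fun x => ?_) (half_lt_self hε)
  rw [sub_apply, ofBound_apply]
  refine le_of_tendsto (((tendsto_const_nhds (x := u n x)).sub (hf x)).norm) ?_
  filter_upwards [eventually_ge_atTop N] with m hm
  rw [← sub_apply]
  refine ((u n - u m).norm_apply_le x).trans (mul_le_mul_of_nonneg_right ?_ (V.pos x).le)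
  rw [← dist_eq_norm]
  exact (hN n hn m hm).le

/-- Restriction of functions to the subspace `S`. -/
noncomputable def restrictCLM (V : Weight X) (S : Set X) :
    Linfty V →L[ℂ] Linfty (V.restrict S) :=
  LinearMap.mkContinuous
    { toFun := fun f => ofBound (fun x => f x) (f.measurable.comp measurable_subtype_coe) ‖f‖
        fun x => f.norm_apply_le x
      map_add' := fun _ _ => rfl
      map_smul' := fun _ _ => rfl } 1
    (fun f => by
      rw [one_mul]
      exact norm_le_of f.norm_nonneg' fun x => f.norm_apply_le x)

theorem restrictCLM_apply (S : Set X) (f : Linfty V) (x : S) : restrictCLM V S f x = f x := rfl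

theorem norm_restrictCLM_apply_le (S : Set X) (f : Linfty V) : ‖restrictCLM V S f‖ ≤ ‖f‖ :=
  norm_le_of f.norm_nonneg' fun x => f.norm_apply_le x

theorem extendZero_of_mem {S : Set X} (hS : MeasurableSet S) (f : Linfty (V.restrict S))
    {x : X} (hx : x ∈ S) : f.extendZero hS x = f ⟨x, hx⟩ :=
  Subtype.val_injective.extend_apply (f : S → ℂ) 0 ⟨x, hx⟩

theorem extendZero_of_notMem {S : Set X} (hS : MeasurableSet S) (f : Linfty (V.restrict S))
    {x : X} (hx : x ∉ S) : f.extendZero hS x = 0 :=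
  Function.extend_apply' _ _ _ (by rintro ⟨y, rfl⟩; exact hx y.2)

/-- Extension of functions by zero, as a continuous linear map. -/
noncomputable def extendZeroCLM (V : Weight X) {S : Set X} (hS : MeasurableSet S) :
    Linfty (V.restrict S) →L[ℂ] Linfty V :=
  LinearMap.mkContinuous
    { toFun := fun f => f.extendZero hS
      map_add' := fun f g => by
        ext x
        by_cases hx : x ∈ S
        · simp [extendZero_of_mem hS _ hx]
        · simp [extendZero_of_notMem hS _ hx]
      map_smul' := fun c f => by
        ext x
        by_cases hx : x ∈ S
        · simp [extendZero_of_mem hS _ hx]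
        · simp [extendZero_of_notMem hS _ hx] } 1
    (fun f => by
      rw [one_mul]
      refine norm_le_of f.norm_nonneg' fun x => ?_
      simp only [LinearMap.coe_mk, AddHom.coe_mk]
      by_cases hx : x ∈ S
      · rw [extendZero_of_mem hS _ hx]
        exact f.norm_apply_le ⟨x, hx⟩
      · rw [extendZero_of_notMem hS _ hx, norm_zero]
        exact mul_nonneg f.norm_nonneg' (V.pos x).le)

/-- The function `V · c_{i(x)}` attached to a finite measurable partition, given by its index
function `i`, and a vector `c`. -/
noncomputable def stepCLM (V : Weight X) {N : ℕ} (i : X → Fin N) (hi : Measurable i) :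
    (Fin N → ℂ) →L[ℂ] Linfty V :=
  LinearMap.toContinuousLinearMap
    { toFun := fun c => ofBound (fun x => V x * c (i x))
        ((Complex.measurable_ofReal.comp V.measurable).mul
          ((measurable_of_countable c).comp hi)) ‖c‖ fun x => by
          rw [norm_mul, Complex.norm_real, Real.norm_of_nonneg (V.pos x).le, mul_comm]
          exact mul_le_mul_of_nonneg_right (norm_le_pi_norm c _) (V.pos x).le
      map_add' := fun c d => ext fun x => mul_add _ _ _
      map_smul' := fun a c => ext fun x => mul_left_comm _ _ _ }

/-- The finite-rank operator `f ↦ V · ψ_{i(x)}(f)` attached to a finite measurable partition,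
given by its index function `i`, and functionals `ψ k`. -/
noncomputable def stepOp {N : ℕ} (i : X → Fin N) (hi : Measurable i)
    (ψ : Fin N → Linfty V →L[ℂ] ℂ) : Linfty V →L[ℂ] Linfty V :=
  (stepCLM V i hi).comp (ContinuousLinearMap.pi ψ)

theorem stepOp_apply {N : ℕ} (i : X → Fin N) (hi : Measurable i)
    (ψ : Fin N → Linfty V →L[ℂ] ℂ) (f : Linfty V) (x : X) :
    stepOp i hi ψ f x = V x * ψ (i x) f := rfl

theorem isCompactOperator_stepOp {N : ℕ} (i : X → Fin N) (hi : Measurable i)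
    (ψ : Fin N → Linfty V →L[ℂ] ℂ) : IsCompactOperator (stepOp i hi ψ) :=
  (isCompactOperator_of_locallyCompactSpace_dom (ContinuousLinearMap.pi ψ)).clm_comp
    (stepCLM V i hi)

/-- The functionals `f ↦ K f x / V x` attached to a compact operator `K` form a totally bounded
family, and the finite approximation can be chosen measurably in `x`. -/
theorem exists_measurable_finite_approx [Nonempty X] {B : Type*} [NormedAddCommGroup B]
    [NormedSpace ℂ B] {K : B →L[ℂ] Linfty V} (hK : IsCompactOperator K) {ε : ℝ} (hε : 0 < ε) :
    ∃ (N : ℕ) (p : Fin N → X) (i : X → Fin N), Measurable i ∧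
      ∀ x, ‖(normalizedEval V x).comp K - (normalizedEval V (p (i x))).comp K‖ ≤ ε := by
  have htb : TotallyBounded (K '' Metric.closedBall 0 1) :=
    (hK.isCompact_closure_image_closedBall (f := (K : B →ₗ[ℂ] Linfty V)) 1).totallyBounded.subset
      subset_closure
  obtain ⟨t, -, htf, ht⟩ := Metric.finite_approx_of_totallyBounded htb (ε / 3) (by positivity)
  have := htf.fintype
  -- `G` records the values at `x` of the finitely many functions of the net
  let G : X → (t → ℂ) := fun x g => normalizedEval V x g.1
  have hG : Measurable G := measurable_pi_lambda _ fun g =>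
    (g.1.measurable).div (Complex.measurable_ofReal.comp V.measurable)
  obtain ⟨C, hC⟩ : ∃ C : ℝ, ∀ g : t, ‖g.1‖ ≤ C := by
    obtain ⟨C, hC⟩ := (Set.finite_range fun g : t => ‖g.1‖).bddAbove
    exact ⟨C, fun g => hC ⟨g, rfl⟩⟩
  have hbd : TotallyBounded (Set.range G) := by
    refine (isCompact_closedBall (0 : t → ℂ) (max C 0)).totallyBounded.subset ?_
    rintro _ ⟨x, rfl⟩
    rw [mem_closedBall_zero_iff, pi_norm_le_iff_of_nonneg (le_max_right _ _)]
    exact fun g => (norm_normalizedEval_apply_le x g.1).trans ((hC g).trans (le_max_left _ _))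
  obtain ⟨s, hs, hsf, hcov⟩ := Metric.finite_approx_of_totallyBounded hbd (ε / 3) (by positivity)
  obtain ⟨q, -, hqf, hq⟩ : ∃ q : Set X, q ⊆ Set.univ ∧ q.Finite ∧ G '' q = s := by
    refine Set.exists_subset_image_finite_and (p := fun s' => s' = s) |>.1 ⟨s, ?_, hsf, rfl⟩
    rwa [Set.image_univ]
  let l : List X := hqf.toFinset.toList
  let a : X := Classical.arbitrary X
  let p : ℕ → X := fun k => l.getD k a
  let j : X → ℕ := fun x => SimpleFunc.nearestPtInd (fun k => G (p k)) l.length (G x)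
  have hj : Measurable j := (SimpleFunc.measurable _).comp hG
  have hjle : ∀ x, j x < l.length + 1 := fun x =>
    Nat.lt_succ_of_le (SimpleFunc.nearestPtInd_le _ _ _)
  have hnear : ∀ x, dist (G (p (j x))) (G x) < ε / 3 := by
    intro x
    obtain ⟨y, hy, hxy⟩ := Set.mem_iUnion₂.1 (hcov ⟨x, rfl⟩)
    rw [← hq] at hy
    obtain ⟨z, hz, rfl⟩ := hy
    have hzl : z ∈ l := by simpa [l] using hz
    obtain ⟨k, hk, hkz⟩ := List.getElem_of_mem hzl
    have hpk : p k = z := by simp [p, hk, hkz]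
    have h := SimpleFunc.edist_nearestPt_le (fun k => G (p k)) (G x) hk.le
    simp only [SimpleFunc.nearestPt, SimpleFunc.map_apply, hpk, edist_dist] at h
    have h' := (ENNReal.ofReal_le_ofReal_iff dist_nonneg).1 h
    refine h'.trans_lt ?_
    rw [dist_comm]
    exact hxy
  refine ⟨l.length + 1, fun k => p k, fun x => ⟨j x, hjle x⟩, ?_, fun x => ?_⟩
  · refine measurable_to_countable' fun k => ?_
    have : (fun x => (⟨j x, hjle x⟩ : Fin (l.length + 1))) ⁻¹' {k} = j ⁻¹' {k.1} := by
      ext x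
      simp [Fin.ext_iff]
    rw [this]
    exact hj (measurableSet_singleton _)
  · rw [← div_one ε]
    refine ContinuousLinearMap.opNorm_bound_of_ball_bound one_pos ε _ fun f hf => ?_
    obtain ⟨g, hg, hfg⟩ := Set.mem_iUnion₂.1 (ht ⟨f, hf, rfl⟩)
    have h1 : ∀ y, ‖normalizedEval V y (K f) - normalizedEval V y g‖ ≤ ε / 3 := fun y => by
      rw [← map_sub]
      refine (norm_normalizedEval_apply_le _ _).trans ?_
      rw [← dist_eq_norm]
      exact (Metric.mem_ball.1 hfg).le
    have h2 : ‖normalizedEval V (p (j x)) g - normalizedEval V x g‖ ≤ ε / 3 := by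
      rw [← dist_eq_norm]
      exact (dist_le_pi_dist (G (p (j x))) (G x) ⟨g, hg⟩).trans (hnear x).le
    simp only [_root_.sub_apply, ContinuousLinearMap.comp_apply]
    have e : normalizedEval V x (K f) - normalizedEval V (p (j x)) (K f)
        = (normalizedEval V x (K f) - normalizedEval V x g)
          - (normalizedEval V (p (j x)) g - normalizedEval V x g)
          - (normalizedEval V (p (j x)) (K f) - normalizedEval V (p (j x)) g) := by ring
    rw [e]
    refine (norm_sub_le _ _).trans ((add_le_add (norm_sub_le _ _) le_rfl).trans ?_)
    linarith [h1 x, h1 (p (j x))]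

end Linfty

/-! ### Positive parts of functionals and compact majorants -/

namespace Linfty
variable {X : Type*} [MeasurableSpace X] {V : Weight X}

theorem isNonneg_zero : (0 : Linfty V).IsNonneg := fun _ => le_rfl

theorem IsNonneg.add {f g : Linfty V} (hf : f.IsNonneg) (hg : g.IsNonneg) : (f + g).IsNonneg :=
  fun x => add_nonneg (hf x) (hg x)

theorem IsNonneg.smul {f : Linfty V} (hf : f.IsNonneg) {t : ℝ} (ht : 0 ≤ t) :
    (t • f).IsNonneg := fun x => by
  rw [real_smul_apply]
  exact mul_nonneg (by exact_mod_cast ht) (hf x)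

theorem IsNonneg.re_nonneg {f : Linfty V} (hf : f.IsNonneg) (x : X) : 0 ≤ (f x).re :=
  (Complex.nonneg_iff.1 (hf x)).1

theorem IsNonneg.ofReal_re {f : Linfty V} (hf : f.IsNonneg) (x : X) : ((f x).re : ℂ) = f x :=
  Complex.ext (Complex.ofReal_re _) ((Complex.ofReal_im _).trans (Complex.nonneg_iff.1 (hf x)).2)

theorem IsNonneg.norm_apply {f : Linfty V} (hf : f.IsNonneg) (x : X) : ‖f x‖ = (f x).re := by
  rw [← hf.ofReal_re x, Complex.norm_real, Real.norm_of_nonneg (hf.re_nonneg x), Complex.ofReal_re]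

theorem IsNonneg.re_le {f : Linfty V} (hf : f.IsNonneg) (x : X) : (f x).re ≤ ‖f‖ * V x :=
  (hf.norm_apply x).symm.le.trans (f.norm_apply_le x)

/-- The order interval `[0, u]`. -/
def interval (u : Linfty V) : Set (Linfty V) :=
  {g | g.IsNonneg ∧ ∀ x, (g x).re ≤ (u x).re}

theorem norm_le_of_mem_interval {u g : Linfty V} (hg : g ∈ interval u) : ‖g‖ ≤ ‖u‖ :=
  norm_le_of u.norm_nonneg' fun x => by
    rw [hg.1.norm_apply]
    exact (hg.2 x).trans ((Complex.re_le_norm _).trans (u.norm_apply_le x))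

theorem zero_mem_interval {u : Linfty V} (hu : u.IsNonneg) : (0 : Linfty V) ∈ interval u :=
  ⟨isNonneg_zero, fun x => by simpa using hu.re_nonneg x⟩

theorem self_mem_interval {u : Linfty V} (hu : u.IsNonneg) : u ∈ interval u :=
  ⟨hu, fun _ => le_rfl⟩

/-- Riesz decomposition: the order interval `[0, u + v]` is contained in `[0, u] + [0, v]`. -/
theorem exists_add_eq_of_mem_interval {u v g : Linfty V} (hu : u.IsNonneg)
    (hv : v.IsNonneg) (hg : g ∈ interval (u + v)) :
    ∃ a ∈ interval u, ∃ b ∈ interval v, a + b = g := by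
  let a : Linfty V := ofBound (fun x => ((min (g x).re (u x).re : ℝ) : ℂ))
    (Complex.measurable_ofReal.comp ((Complex.measurable_re.comp g.measurable).min
      (Complex.measurable_re.comp u.measurable))) ‖u‖ (fun x => by
        rw [Complex.norm_real, Real.norm_of_nonneg (le_min (hg.1.re_nonneg x) (hu.re_nonneg x))]
        exact (min_le_right _ _).trans (hu.re_le x))
  have ha : ∀ x, a x = ((min (g x).re (u x).re : ℝ) : ℂ) := fun x => rfl
  have hs : ∀ x, (g - a) x = (((g x).re - min (g x).re (u x).re : ℝ) : ℂ) := fun x => by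
    rw [sub_apply, ha, Complex.ofReal_sub, hg.1.ofReal_re]
  refine ⟨a, ⟨fun x => ?_, fun x => ?_⟩, g - a, ⟨fun x => ?_, fun x => ?_⟩, add_sub_cancel _ _⟩
  · rw [ha]
    exact_mod_cast le_min (hg.1.re_nonneg x) (hu.re_nonneg x)
  · rw [ha, Complex.ofReal_re]
    exact min_le_right _ _
  · rw [hs]
    exact_mod_cast sub_nonneg.2 (min_le_left _ _)
  · have h := hg.2 x
    rw [hs, Complex.ofReal_re]
    rw [add_apply, Complex.add_re] at h
    rcases min_cases (g x).re (u x).re with ⟨e, _⟩ | ⟨e, _⟩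
    · rw [e, sub_self]
      exact hv.re_nonneg x
    · rw [e]; linarith

/-- For `u ≥ 0`, the supremum of `Re φ` over the order interval `[0, u]`: the value at `u` of the
positive part of `Re φ`. -/
noncomputable def posSup (φ : Linfty V →L[ℂ] ℂ) (u : Linfty V) : ℝ :=
  sSup ((fun g => (φ g).re) '' interval u)

theorem bddAbove_re_image_interval (φ : Linfty V →L[ℂ] ℂ) (u : Linfty V) :
    BddAbove ((fun g => (φ g).re) '' interval u) := by
  refine ⟨‖φ‖ * ‖u‖, ?_⟩
  rintro _ ⟨g, hg, rfl⟩
  exact (Complex.re_le_norm _).trans ((φ.le_opNorm g).trans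
    (mul_le_mul_of_nonneg_left (norm_le_of_mem_interval hg) (norm_nonneg φ)))

theorem re_le_posSup (φ : Linfty V →L[ℂ] ℂ) {u g : Linfty V} (hg : g ∈ interval u) :
    (φ g).re ≤ posSup φ u :=
  le_csSup (bddAbove_re_image_interval φ u) ⟨g, hg, rfl⟩

theorem posSup_le (φ : Linfty V →L[ℂ] ℂ) {u : Linfty V} (hu : u.IsNonneg) {c : ℝ}
    (h : ∀ g ∈ interval u, (φ g).re ≤ c) : posSup φ u ≤ c :=
  csSup_le ⟨_, 0, zero_mem_interval hu, rfl⟩ (by rintro _ ⟨g, hg, rfl⟩; exact h g hg)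

theorem posSup_nonneg (φ : Linfty V →L[ℂ] ℂ) {u : Linfty V} (hu : u.IsNonneg) :
    0 ≤ posSup φ u := by
  simpa using re_le_posSup φ (zero_mem_interval hu)

theorem posSup_add (φ : Linfty V →L[ℂ] ℂ) {u v : Linfty V} (hu : u.IsNonneg)
    (hv : v.IsNonneg) : posSup φ (u + v) = posSup φ u + posSup φ v := by
  refine le_antisymm (posSup_le φ (hu.add hv) fun g hg => ?_) ?_
  · obtain ⟨a, ha, b, hb, rfl⟩ := exists_add_eq_of_mem_interval hu hv hg
    rw [map_add, Complex.add_re]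
    exact add_le_add (re_le_posSup φ ha) (re_le_posSup φ hb)
  · rw [← le_sub_iff_add_le]
    refine posSup_le φ hu fun a ha => ?_
    rw [le_sub_comm]
    refine posSup_le φ hv fun b hb => ?_
    rw [le_sub_iff_add_le', ← Complex.add_re, ← map_add]
    exact re_le_posSup φ ⟨ha.1.add hb.1, fun x => by
      simpa using add_le_add (ha.2 x) (hb.2 x)⟩

theorem posSup_smul (φ : Linfty V →L[ℂ] ℂ) {u : Linfty V} (hu : u.IsNonneg) {t : ℝ}
    (ht : 0 ≤ t) : posSup φ (t • u) = t * posSup φ u := by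
  have key : ∀ (t : ℝ) (u : Linfty V), u.IsNonneg → 0 ≤ t →
      t * posSup φ u ≤ posSup φ (t • u) := by
    intro t u hu ht
    rcases ht.eq_or_lt with rfl | ht0
    · rw [zero_mul]
      exact posSup_nonneg φ (hu.smul le_rfl)
    · rw [← le_div_iff₀' ht0]
      refine posSup_le φ hu fun g hg => ?_
      rw [le_div_iff₀' ht0]
      have h : (φ (t • g)).re ≤ posSup φ (t • u) := re_le_posSup φ ⟨hg.1.smul ht, fun x => by
        simpa using mul_le_mul_of_nonneg_left (hg.2 x) ht⟩
      rw [← Complex.coe_smul, map_smul] at h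
      simpa using h
  refine le_antisymm ?_ (key t u hu ht)
  rcases ht.eq_or_lt with rfl | ht0
  · rw [zero_mul, zero_smul]
    refine posSup_le φ isNonneg_zero fun g hg => ?_
    have h0 : g = 0 := norm_le_zero_iff.1 ((norm_le_of_mem_interval hg).trans norm_zero.le)
    simp [h0]
  · have h := key t⁻¹ (t • u) (hu.smul ht) (inv_nonneg.2 ht)
    rwa [smul_smul, inv_mul_cancel₀ ht0.ne', one_smul, inv_mul_le_iff₀ ht0] at h

theorem posSup_le_add (φ ψ : Linfty V →L[ℂ] ℂ) {u : Linfty V} (hu : u.IsNonneg) :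
    posSup φ u ≤ posSup ψ u + ‖φ - ψ‖ * ‖u‖ := by
  refine posSup_le φ hu fun g hg => ?_
  have h1 : (φ g).re = (ψ g).re + ((φ - ψ) g).re := by simp
  rw [h1]
  refine add_le_add (re_le_posSup ψ hg) ((Complex.re_le_norm _).trans ?_)
  exact ((φ - ψ).le_opNorm g).trans
    (mul_le_mul_of_nonneg_left (norm_le_of_mem_interval hg) (norm_nonneg _))

theorem abs_posSup_sub_le (φ ψ : Linfty V →L[ℂ] ℂ) {u : Linfty V} (hu : u.IsNonneg) :
    |posSup φ u - posSup ψ u| ≤ ‖φ - ψ‖ * ‖u‖ := by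
  have h1 := posSup_le_add φ ψ hu
  have h2 := posSup_le_add ψ φ hu
  rw [norm_sub_rev] at h2
  exact abs_le.2 ⟨by linarith, by linarith⟩

/-- The positive part of the real part of `f`. -/
noncomputable def rePos (f : Linfty V) : Linfty V :=
  ofBound (fun x => ((max (f x).re 0 : ℝ) : ℂ))
    (Complex.measurable_ofReal.comp ((Complex.measurable_re.comp f.measurable).max
      measurable_const)) ‖f‖ fun x => by
    rw [Complex.norm_real, Real.norm_of_nonneg (le_max_right _ _)]
    exact max_le ((Complex.re_le_norm _).trans (f.norm_apply_le x))
      (mul_nonneg f.norm_nonneg' (V.pos x).le)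

theorem rePos_apply (f : Linfty V) (x : X) : rePos f x = ((max (f x).re 0 : ℝ) : ℂ) := rfl

theorem isNonneg_rePos (f : Linfty V) : (rePos f).IsNonneg := fun x => by
  rw [rePos_apply]
  exact_mod_cast le_max_right _ _

theorem norm_rePos_le (f : Linfty V) : ‖rePos f‖ ≤ ‖f‖ :=
  norm_le_of f.norm_nonneg' fun x => by
    rw [rePos_apply, Complex.norm_real, Real.norm_of_nonneg (le_max_right _ _)]
    exact max_le ((Complex.re_le_norm _).trans (f.norm_apply_le x))
      (mul_nonneg f.norm_nonneg' (V.pos x).le)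

/-- The additive extension of `posSup φ` may be computed from any decomposition of `Re f` as a
difference of nonnegative functions. -/
theorem posSup_rePos_sub (φ : Linfty V →L[ℂ] ℂ) {f u v : Linfty V} (hu : u.IsNonneg)
    (hv : v.IsNonneg) (h : ∀ x, (f x).re = (u x).re - (v x).re) :
    posSup φ (rePos f) - posSup φ (rePos (-f)) = posSup φ u - posSup φ v := by
  have e : rePos f + v = rePos (-f) + u := by
    ext x
    rw [add_apply, add_apply, rePos_apply, rePos_apply, ← hu.ofReal_re, ← hv.ofReal_re, neg_apply,
      Complex.neg_re, h x, ← Complex.ofReal_add, ← Complex.ofReal_add]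
    congr 1
    rcases le_total (u x).re (v x).re with h' | h'
    · rw [max_eq_right (by linarith), max_eq_left (by linarith)]; ring
    · rw [max_eq_left (by linarith), max_eq_right (by linarith)]; ring
  have h2 := congrArg (posSup φ) e
  rw [posSup_add φ (isNonneg_rePos _) hv, posSup_add φ (isNonneg_rePos _) hu] at h2
  linarith

/-- The real-linear functional extending `posSup φ` from the cone of nonnegative functions; it
depends on the real part of its argument only. -/
noncomputable def realPosPart (φ : Linfty V →L[ℂ] ℂ) : Linfty V →ₗ[ℝ] ℝ where
  toFun f := posSup φ (rePos f) - posSup φ (rePos (-f))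
  map_add' f g := by
    have hf := isNonneg_rePos f
    have hg := isNonneg_rePos g
    have hf' := isNonneg_rePos (-f)
    have hg' := isNonneg_rePos (-g)
    rw [posSup_rePos_sub φ (hf.add hg) (hf'.add hg') fun x => ?_, posSup_add φ hf hg,
      posSup_add φ hf' hg']
    · ring
    · simp only [add_apply, rePos_apply, neg_apply, Complex.add_re, Complex.neg_re,
        Complex.ofReal_re]
      linarith [max_zero_sub_eq_self (f x).re, max_zero_sub_eq_self (g x).re]
  map_smul' t f := by
    have hf := isNonneg_rePos f
    have hf' := isNonneg_rePos (-f)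
    rw [RingHom.id_apply, smul_eq_mul]
    rcases le_total 0 t with ht | ht
    · rw [posSup_rePos_sub φ (hf.smul ht) (hf'.smul ht) fun x => ?_, posSup_smul φ hf ht,
        posSup_smul φ hf' ht, mul_sub]
      simp only [real_smul_apply, rePos_apply, neg_apply, Complex.neg_re, Complex.re_ofReal_mul,
        Complex.ofReal_re]
      rw [← mul_sub, max_zero_sub_eq_self]
    · have ht' : 0 ≤ -t := by linarith
      rw [posSup_rePos_sub φ (hf'.smul ht') (hf.smul ht') fun x => ?_, posSup_smul φ hf ht',
        posSup_smul φ hf' ht']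
      · ring
      · simp only [real_smul_apply, rePos_apply, neg_apply, Complex.neg_re, Complex.re_ofReal_mul,
          Complex.ofReal_re]
        nlinarith [max_zero_sub_eq_self (f x).re]

theorem realPosPart_apply (φ : Linfty V →L[ℂ] ℂ) (f : Linfty V) :
    realPosPart φ f = posSup φ (rePos f) - posSup φ (rePos (-f)) := rfl

theorem abs_realPosPart_sub_le (φ ψ : Linfty V →L[ℂ] ℂ) (f : Linfty V) :
    |realPosPart φ f - realPosPart ψ f| ≤ 2 * ‖φ - ψ‖ * ‖f‖ := by
  rw [realPosPart_apply, realPosPart_apply]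
  have h1 := abs_posSup_sub_le φ ψ (isNonneg_rePos f)
  have h2 := abs_posSup_sub_le φ ψ (isNonneg_rePos (-f))
  have h3 := mul_le_mul_of_nonneg_left (norm_rePos_le f) (norm_nonneg (φ - ψ))
  have h4 := mul_le_mul_of_nonneg_left (norm_rePos_le (-f)) (norm_nonneg (φ - ψ))
  rw [norm_neg] at h4
  rw [abs_le] at *
  constructor <;> linarith

theorem norm_extendRCLike_realPosPart_sub_le (φ ψ : Linfty V →L[ℂ] ℂ) (f : Linfty V) :
    ‖(Module.Dual.extendRCLike (realPosPart φ) f : ℂ)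
      - Module.Dual.extendRCLike (realPosPart ψ) f‖ ≤ 2 * ‖φ - ψ‖ * ‖f‖ := by
  have h := Module.Dual.norm_extendRCLike_le_seminorm (𝕜 := ℂ) (realPosPart φ - realPosPart ψ)
    (p := (2 * ‖φ - ψ‖₊) • normSeminorm ℂ (Linfty V)) (fun g => abs_realPosPart_sub_le φ ψ g) f
  refine le_trans (le_of_eq ?_) h
  congr 1
  simp [Module.Dual.extendRCLike_apply]
  ring

theorem realPosPart_zero (f : Linfty V) : realPosPart 0 f = 0 := by
  have h : ∀ u : Linfty V, u.IsNonneg → posSup 0 u = 0 := fun u hu =>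
    le_antisymm (posSup_le 0 hu fun g _ => by simp) (posSup_nonneg 0 hu)
  rw [realPosPart_apply, h _ (isNonneg_rePos _), h _ (isNonneg_rePos _), sub_zero]

/-- The positive part of the real part of a bounded functional `φ`: the complex-linear functional
with `posPart φ f = sup {Re φ g : 0 ≤ g ≤ f}` for `f ≥ 0`. -/
noncomputable def posPart (φ : Linfty V →L[ℂ] ℂ) : Linfty V →L[ℂ] ℂ :=
  (Module.Dual.extendRCLike (realPosPart φ)).mkContinuous (2 * ‖φ‖) fun f => by
    have h := norm_extendRCLike_realPosPart_sub_le φ 0 f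
    have h0 : (Module.Dual.extendRCLike (realPosPart (0 : Linfty V →L[ℂ] ℂ)) f : ℂ) = 0 := by
      simp [Module.Dual.extendRCLike_apply, realPosPart_zero]
    rwa [h0, sub_zero, sub_zero] at h

theorem norm_posPart_sub_apply_le (φ ψ : Linfty V →L[ℂ] ℂ) (f : Linfty V) :
    ‖posPart φ f - posPart ψ f‖ ≤ 2 * ‖φ - ψ‖ * ‖f‖ :=
  norm_extendRCLike_realPosPart_sub_le φ ψ f

theorem posPart_apply_of_isNonneg (φ : Linfty V →L[ℂ] ℂ) {f : Linfty V} (hf : f.IsNonneg) :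
    posPart φ f = posSup φ f := by
  have h1 : realPosPart φ f = posSup φ f := by
    rw [realPosPart_apply, posSup_rePos_sub φ hf isNonneg_zero (by simp)]
    have h0 := posSup_smul φ (isNonneg_zero (V := V)) (le_refl 0)
    rw [smul_zero, zero_mul] at h0
    rw [h0, sub_zero]
  have h2 : realPosPart φ (Complex.I • f) = 0 := by
    rw [realPosPart_apply, posSup_rePos_sub φ isNonneg_zero isNonneg_zero fun x => ?_, sub_self]
    rw [smul_apply, ← hf.ofReal_re]
    simp
  change (Module.Dual.extendRCLike (realPosPart φ) f : ℂ) = _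
  rw [Module.Dual.extendRCLike_apply]
  simp [h1, h2]

/-- A compact operator is dominated on nonnegative functions by a positive compact operator,
namely by the operator `K⁺ f (x) = sup {Re K g (x) : 0 ≤ g ≤ f}`. -/
theorem exists_positive_compact_majorant [Nonempty X] {K : Linfty V →L[ℂ] Linfty V}
    (hK : IsCompactOperator K) :
    ∃ T : Linfty V →L[ℂ] Linfty V, IsPositiveOperator T ∧ IsCompactOperator T ∧
      ∀ f : Linfty V, f.IsNonneg → ∀ x, (K f x).re ≤ (T f x).re := by
  set φ : X → Linfty V →L[ℂ] ℂ := fun x => (normalizedEval V x).comp K with hφ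
  have happrox : ∀ n : ℕ, ∃ F : Linfty V →L[ℂ] Linfty V, IsCompactOperator F ∧
      ∀ f x, ‖F f x - V x * posPart (φ x) f‖ ≤ 1 / ((n : ℝ) + 1) * ‖f‖ * V x := by
    intro n
    obtain ⟨N, p, i, hi, hp⟩ := exists_measurable_finite_approx hK
      (half_pos (Nat.one_div_pos_of_nat (α := ℝ) (n := n)))
    refine ⟨stepOp i hi fun k => posPart (φ (p k)), isCompactOperator_stepOp _ _ _,
      fun f x => ?_⟩
    rw [stepOp_apply, ← mul_sub, norm_mul, Complex.norm_real, Real.norm_of_nonneg (V.pos x).le,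
      mul_comm]
    refine mul_le_mul_of_nonneg_right ?_ (V.pos x).le
    rw [norm_sub_rev]
    refine (norm_posPart_sub_apply_le _ _ f).trans
      (mul_le_mul_of_nonneg_right ?_ (norm_nonneg f))
    linarith [hp x]
  choose F hFc hF using happrox
  have hlim0 : ∀ c d : ℝ, Tendsto (fun n : ℕ => 1 / ((n : ℝ) + 1) * c * d) atTop (nhds 0) :=
    fun c d => by
      simpa using (tendsto_one_div_add_atTop_nhds_zero_nat.mul_const c).mul_const d
  have hmeas : ∀ f, Measurable fun x => V x * posPart (φ x) f := fun f =>
    measurable_of_tendsto_metrizable (fun n => (F n f).measurable)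
      (tendsto_pi_nhds.2 fun x => tendsto_iff_norm_sub_tendsto_zero.2
        (squeeze_zero (fun _ => norm_nonneg _) (fun n => hF n f x) (hlim0 _ _)))
  have hbd : ∀ f x, ‖V x * posPart (φ x) f‖ ≤ (1 + ‖F 0‖) * ‖f‖ * V x := by
    intro f x
    have h1 := hF 0 f x
    have h2 := (F 0 f).norm_apply_le x
    have h3 := mul_le_mul_of_nonneg_right ((F 0).le_opNorm f) (V.pos x).le
    have h4 := norm_sub_norm_le (V x * posPart (φ x) f) (F 0 f x)
    rw [norm_sub_rev] at h4
    simp only [Nat.cast_zero, zero_add, div_one, one_mul] at h1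
    linarith
  let T : Linfty V →L[ℂ] Linfty V := LinearMap.mkContinuous
    { toFun := fun f => ofBound (fun x => V x * posPart (φ x) f) (hmeas f)
        ((1 + ‖F 0‖) * ‖f‖) (hbd f)
      map_add' := fun f g => ext fun x => by simp [mul_add]
      map_smul' := fun c f => ext fun x => by simp [mul_left_comm] } (1 + ‖F 0‖)
    fun f => norm_le_of (by positivity) (hbd f)
  have hT : ∀ f x, T f x = V x * posPart (φ x) f := fun _ _ => rfl
  have hV : ∀ x, (0 : ℂ) ≤ V x := fun x => by exact_mod_cast (V.pos x).le
  refine ⟨T, fun f hf x => ?_, ?_, fun f hf x => ?_⟩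
  · rw [hT, posPart_apply_of_isNonneg _ hf]
    exact mul_nonneg (hV x) (by exact_mod_cast posSup_nonneg _ hf)
  · refine isCompactOperator_of_tendsto (l := atTop) (F := F) ?_ (Eventually.of_forall hFc)
    refine tendsto_iff_norm_sub_tendsto_zero.2
      (squeeze_zero (fun _ => norm_nonneg _) (fun n => ?_) tendsto_one_div_add_atTop_nhds_zero_nat)
    refine ContinuousLinearMap.opNorm_le_bound _ (by positivity) fun f => ?_
    refine norm_le_of (by positivity) fun x => ?_
    rw [_root_.sub_apply, sub_apply, hT]
    exact hF n f x
  · rw [hT, posPart_apply_of_isNonneg _ hf, ← Complex.ofReal_mul, Complex.ofReal_re,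
      ← mul_normalizedEval x (K f), Complex.re_ofReal_mul]
    exact mul_le_mul_of_nonneg_left (re_le_posSup (φ x) (self_mem_interval hf)) (V.pos x).le

end Linfty

/-! ### Domination of the kernel operator -/

section
variable {E : Type*} [MeasurableSpace E] {V : Weight E} {P : Kernel E E}

theorem kernelOp_apply (hP : IsKernelInto V P) (f : Linfty V) (x : E) :
    kernelOp V P hP f x = ∫ y, f y ∂(P x) := rfl

theorem kernelOp_apply_of_isNonneg (hP : IsKernelInto V P) {f : Linfty V} (hf : f.IsNonneg)
    (x : E) : kernelOp V P hP f x = ((∫ y, (f y).re ∂(P x) : ℝ) : ℂ) := by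
  have h : ∫ y, f y ∂(P x) = ∫ y, ((f y).re : ℂ) ∂(P x) :=
    integral_congr_ae (Eventually.of_forall fun y => (hf.ofReal_re y).symm)
  exact h.trans integral_ofReal

theorem isNonneg_kernelOp (hP : IsKernelInto V P) {f : Linfty V} (hf : f.IsNonneg) :
    (kernelOp V P hP f).IsNonneg := fun x => by
  rw [kernelOp_apply_of_isNonneg hP hf]
  exact_mod_cast integral_nonneg fun y => hf.re_nonneg y

theorem setIntegral_weight_le {s : Set E} {c : ℝ≥0} {x : E}
    (h : ∫⁻ y in s, ENNReal.ofReal (V y) ∂(P x) ≤ c * ENNReal.ofReal (V x)) :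
    ∫ y in s, V y ∂(P x) ≤ c * V x := by
  rw [integral_eq_lintegral_of_nonneg_ae (Eventually.of_forall fun y => (V.pos y).le)
    V.measurable.aestronglyMeasurable]
  refine ENNReal.toReal_le_of_le_ofReal (mul_nonneg c.coe_nonneg (V.pos x).le) ?_
  rw [ENNReal.ofReal_mul c.coe_nonneg, ENNReal.ofReal_coe_nnreal]
  exact h

theorem setLIntegral_le_of_tailBound_le {E_K : Set E} {A : ℝ} {t : ℝ≥0}
    (h : tailBound V P E_K A ≤ t) {x : E} (hx : x ∈ E_K) :
    ∫⁻ y in {y | A < V y}, ENNReal.ofReal (V y) ∂(P x) ≤ t * ENNReal.ofReal (V x) := by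
  rw [← ENNReal.div_le_iff (ENNReal.ofReal_pos.2 (V.pos x)).ne' ENNReal.ofReal_ne_top]
  exact (le_iSup₂_of_le (f := fun x (_ : x ∈ E_K) =>
    (∫⁻ y in {y | A < V y}, ENNReal.ofReal (V y) ∂(P x)) / ENNReal.ofReal (V x))
      x hx le_rfl).trans h

/-- Splitting `f` at the level `A` of `V` reduces the domination of `P` on `E_K` to the operator
`K_A`, made positive by passing to its compact majorant, and to the tail bound. -/
theorem localDomination_of_sublevelDomination [Nonempty E] (hP : IsKernelInto V P)
    {E_K : Set E} (hE_K : MeasurableSet E_K) {A : ℝ} {θ₄ θ₂ θ : ℝ≥0}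
    (hθ₂ : (θ₂ : ℝ≥0∞) = tailBound V P E_K A + θ₄) (hθ : 0 < θ) (hle : θ₂ ≤ θ)
    (hlt : (θ : ℝ≥0∞) < spectralRadius ℂ (kernelOp V P hP))
    {K_A : Linfty (V.restrict (V.sublevel A)) →L[ℂ] Linfty (V.restrict E_K)}
    (hK_A : IsCompactOperator K_A) (hdom : SublevelDomination V P hP E_K A θ₄ K_A) :
    LocalDomination V P hP E_K θ := by
  have hS := V.measurableSet_sublevel A
  set K₀ : Linfty V →L[ℂ] Linfty V :=
    (Linfty.extendZeroCLM V hE_K).comp (K_A.comp (Linfty.restrictCLM V (V.sublevel A))) with hK₀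
  have hK₀c : IsCompactOperator K₀ :=
    (hK_A.comp_clm (Linfty.restrictCLM V (V.sublevel A))).clm_comp (Linfty.extendZeroCLM V hE_K)
  obtain ⟨T, hTpos, hTc, hT⟩ := Linfty.exists_positive_compact_majorant hK₀c
  refine ⟨hθ, hlt, T, hTpos, hTc, fun x hx f hf => ⟨isNonneg_kernelOp hP hf x, ?_⟩⟩
  obtain ⟨t, ht⟩ : ∃ t : ℝ≥0, tailBound V P E_K A = t := by
    refine ⟨(tailBound V P E_K A).toNNReal, (ENNReal.coe_toNNReal fun h => ?_).symm⟩
    rw [h, top_add] at hθ₂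
    exact ENNReal.coe_ne_top hθ₂
  have htθ : t + θ₄ = θ₂ := by
    rw [ht] at hθ₂
    exact_mod_cast hθ₂.symm
  set f₁ := Linfty.restrictCLM V (V.sublevel A) f with hf₁
  set g := f₁.extendZero hS with hg
  have hf₁0 : f₁.IsNonneg := fun y => hf y
  have hKf : K₀ f x = K_A f₁ ⟨x, hx⟩ := Linfty.extendZero_of_mem hE_K _ hx
  -- the part of `f` on the sublevel set
  have h1 : (kernelOp V P hP g x).re ≤ (T f x).re + θ₄ * V x * ‖f‖ := by
    have h := (Complex.le_def.1 (hdom ⟨x, hx⟩ f₁ hf₁0).2).1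
    rw [Complex.add_re, Complex.ofReal_re, ← hKf] at h
    refine h.trans (add_le_add (hT f hf x) ?_)
    exact mul_le_mul_of_nonneg_left (Linfty.norm_restrictCLM_apply_le _ f)
      (mul_nonneg θ₄.coe_nonneg (V.pos x).le)
  -- the part of `f` on the tail
  have h2 : (kernelOp V P hP (f - g) x).re ≤ ‖f‖ * (t * V x) := by
    have hmeas : MeasurableSet {y | A < V y} := measurableSet_lt measurable_const V.measurable
    have hb : ∀ y, ‖(f - g) y‖ ≤ {y | A < V y}.indicator (fun y => ‖f‖ * V y) y := by
      intro y
      by_cases hy : A < V y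
      · rw [Set.indicator_of_mem (by exact hy), Linfty.sub_apply, hg,
          Linfty.extendZero_of_notMem hS _ (by simpa [Weight.sublevel] using hy), sub_zero]
        exact f.norm_apply_le y
      · rw [Set.indicator_of_notMem (by exact hy), Linfty.sub_apply, hg,
          Linfty.extendZero_of_mem hS _ (show y ∈ V.sublevel A from not_lt.1 hy), hf₁,
          Linfty.restrictCLM_apply, sub_self, norm_zero]
    refine (Complex.re_le_norm _).trans ?_
    rw [kernelOp_apply]
    refine (norm_integral_le_of_norm_le (((hP.integrable x).const_mul ‖f‖).indicator hmeas)
      (Eventually.of_forall hb)).trans ?_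
    rw [integral_indicator hmeas, integral_const_mul]
    exact mul_le_mul_of_nonneg_left
      (setIntegral_weight_le (setLIntegral_le_of_tailBound_le ht.le hx)) f.norm_nonneg'
  have h3 : (kernelOp V P hP f x).re ≤ (T f x).re + θ * V x * ‖f‖ := by
    have e : kernelOp V P hP f x = kernelOp V P hP g x + kernelOp V P hP (f - g) x := by
      rw [← Linfty.add_apply, ← map_add, add_sub_cancel]
    have hc : (t : ℝ) + θ₄ ≤ θ := by
      rw [← NNReal.coe_add, htθ]
      exact_mod_cast hle
    have h4 := mul_le_mul_of_nonneg_right hc (mul_nonneg (V.pos x).le f.norm_nonneg')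
    rw [e, Complex.add_re]
    linarith
  rw [← (isNonneg_kernelOp hP hf).ofReal_re x, ← (hTpos f hf).ofReal_re x, ← Complex.ofReal_add]
  exact_mod_cast h3

/-- Outside `E_K` the Lyapunov inequality bounds `P f`, and the positivity of `K` allows adding
`K f`; so the domination holds on the whole space. -/
theorem exists_global_domination {hP : IsKernelInto V P} {E_K : Set E} {θ₁ θ : ℝ≥0}
    (h1 : GlobalLyapunov V P hP E_K θ₁) (h2 : LocalDomination V P hP E_K θ) :
    ∃ K : Linfty V →L[ℂ] Linfty V, IsCompactOperator K ∧ IsPositiveOperator K ∧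
      ∀ f : Linfty V, f.IsNonneg → ∀ x,
        (kernelOp V P hP f x).re ≤ (K f x).re + max θ₁ θ * V x * ‖f‖ := by
  obtain ⟨-, -, K, hKpos, hKc, hK⟩ := h2
  obtain ⟨-, -, h1⟩ := h1
  refine ⟨K, hKc, hKpos, fun f hf x => ?_⟩
  have hVf : 0 ≤ V x * ‖f‖ := mul_nonneg (V.pos x).le f.norm_nonneg'
  rw [mul_assoc]
  by_cases hx : x ∈ E_K
  · have h := (Complex.le_def.1 (hK x hx f hf).2).1
    rw [Complex.add_re, Complex.ofReal_re, mul_assoc] at h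
    exact h.trans (add_le_add le_rfl
      (mul_le_mul_of_nonneg_right (by exact_mod_cast le_max_right θ₁ θ) hVf))
  · rw [kernelOp_apply_of_isNonneg hP hf, Complex.ofReal_re]
    have h := setIntegral_weight_le (s := Set.univ) (x := x) (c := θ₁) (by simpa using h1 x hx)
    rw [setIntegral_univ] at h
    calc ∫ y, (f y).re ∂(P x) ≤ ∫ y, ‖f‖ * V y ∂(P x) :=
          integral_mono (hP.integrable_apply f x).re ((hP.integrable x).const_mul _)
            fun y => hf.re_le y
      _ = ‖f‖ * ∫ y, V y ∂(P x) := integral_const_mul _ _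
      _ ≤ ‖f‖ * (θ₁ * V x) := mul_le_mul_of_nonneg_left h f.norm_nonneg'
      _ = θ₁ * (V x * ‖f‖) := by ring
      _ ≤ max θ₁ θ * (V x * ‖f‖) :=
          mul_le_mul_of_nonneg_right (by exact_mod_cast le_max_left θ₁ θ) hVf
      _ ≤ _ := le_add_of_nonneg_left ((hKpos f hf).re_nonneg x)

end

/-! ### Operators induced by finite kernels -/

section
variable {E : Type*} [MeasurableSpace E] {V : Weight E}

namespace Linfty

theorem measurable_normalizedEval (f : Linfty V) : Measurable fun y => normalizedEval V y f :=
  f.measurable.div (Complex.measurable_ofReal.comp V.measurable)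

theorem integrable_normalizedEval (f : Linfty V) (μ : Measure E) [IsFiniteMeasure μ] :
    Integrable (fun y => normalizedEval V y f) μ :=
  Integrable.of_bound f.measurable_normalizedEval.aestronglyMeasurable ‖f‖
    (Eventually.of_forall fun y => norm_normalizedEval_apply_le y f)

end Linfty

open Linfty

theorem norm_integral_normalizedEval_le (f : Linfty V) (μ : Measure E) [IsFiniteMeasure μ] :
    ‖∫ y, normalizedEval V y f ∂μ‖ ≤ μ.real Set.univ * ‖f‖ := by
  rw [mul_comm]
  exact norm_integral_le_of_norm_le_const
    (Eventually.of_forall fun y => norm_normalizedEval_apply_le y f)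

/-- The operator `f ↦ V · Q(f / V)` on `L^∞(V)` induced by a finite kernel `Q`. -/
noncomputable def weightedOp (V : Weight E) (Q : Kernel E E) [IsFiniteKernel Q] :
    Linfty V →L[ℂ] Linfty V :=
  have hb : ∀ (f : Linfty V) x, ‖(V x : ℂ) * ∫ y, normalizedEval V y f ∂(Q x)‖
      ≤ (Q.bound.toReal * ‖f‖) * V x := fun f x => by
    rw [norm_mul, Complex.norm_real, Real.norm_of_nonneg (V.pos x).le, mul_comm]
    refine mul_le_mul_of_nonneg_right ((norm_integral_normalizedEval_le f (Q x)).trans ?_)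
      (V.pos x).le
    exact mul_le_mul_of_nonneg_right
      (ENNReal.toReal_mono (Kernel.bound_ne_top Q) (Q.measure_le_bound x Set.univ)) (norm_nonneg f)
  LinearMap.mkContinuous
    { toFun := fun f => ofBound (fun x => V x * ∫ y, normalizedEval V y f ∂(Q x))
        ((Complex.measurable_ofReal.comp V.measurable).mul
          f.measurable_normalizedEval.stronglyMeasurable.integral_kernel.measurable)
        (Q.bound.toReal * ‖f‖) (hb f)
      map_add' := fun f g => Linfty.ext fun x => by
        simp only [map_add, ofBound_apply, Linfty.add_apply]
        rw [integral_add (f.integrable_normalizedEval _) (g.integrable_normalizedEval _), mul_add]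
      map_smul' := fun c f => Linfty.ext fun x => by
        simp only [map_smul, ofBound_apply, Linfty.smul_apply, smul_eq_mul, RingHom.id_apply]
        rw [integral_const_mul, mul_left_comm] }
    Q.bound.toReal fun f => norm_le_of (by positivity) (hb f)

theorem weightedOp_apply (Q : Kernel E E) [IsFiniteKernel Q] (f : Linfty V) (x : E) :
    weightedOp V Q f x = V x * ∫ y, normalizedEval V y f ∂(Q x) := rfl

theorem norm_weightedOp_apply_le (Q : Kernel E E) [IsFiniteKernel Q] {f : Linfty V} {c : ℝ}
    (hc : 0 ≤ c) (h : ∀ x, ‖∫ y, normalizedEval V y f ∂(Q x)‖ ≤ c) : ‖weightedOp V Q f‖ ≤ c :=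
  norm_le_of hc fun x => by
    rw [weightedOp_apply, norm_mul, Complex.norm_real, Real.norm_of_nonneg (V.pos x).le, mul_comm]
    exact mul_le_mul_of_nonneg_right (h x) (V.pos x).le

theorem norm_weightedOp_le (Q : Kernel E E) [IsFiniteKernel Q] {c : ℝ} (hc : 0 ≤ c)
    (h : ∀ x, (Q x).real Set.univ ≤ c) : ‖weightedOp V Q‖ ≤ c :=
  ContinuousLinearMap.opNorm_le_bound _ hc fun f =>
    norm_weightedOp_apply_le Q (by positivity) fun x =>
      (norm_integral_normalizedEval_le f (Q x)).trans
        (mul_le_mul_of_nonneg_right (h x) (norm_nonneg f))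

/-- An operator on `L^∞(V)` is boundedly continuous if it preserves the pointwise
convergence of norm-bounded sequences. -/
def IsBoundedlyContinuous (U : Linfty V →L[ℂ] Linfty V) : Prop :=
  ∀ (f : ℕ → Linfty V) (g : Linfty V) (C : ℝ), (∀ n, ‖f n‖ ≤ C) →
    (∀ x, Tendsto (fun n => f n x) atTop (nhds (g x))) →
      ∀ x, Tendsto (fun n => U (f n) x) atTop (nhds (U g x))

theorem IsBoundedlyContinuous.pow {U : Linfty V →L[ℂ] Linfty V} (hU : IsBoundedlyContinuous U)
    (k : ℕ) : IsBoundedlyContinuous (U ^ k) := by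
  induction k with
  | zero => exact fun f g C _ hf => hf
  | succ k ih =>
    intro f g C hC hf
    rw [pow_succ]
    exact ih (fun n => U (f n)) (U g) (‖U‖ * C)
      (fun n => (U.le_opNorm _).trans (mul_le_mul_of_nonneg_left (hC n) (norm_nonneg U)))
      (hU f g C hC hf)

theorem tendsto_normalizedEval {f : ℕ → Linfty V} {g : Linfty V} {x : E}
    (h : Tendsto (fun n => f n x) atTop (nhds (g x))) :
    Tendsto (fun n => normalizedEval V x (f n)) atTop (nhds (normalizedEval V x g)) :=
  h.div_const _

theorem isBoundedlyContinuous_weightedOp (Q : Kernel E E) [IsFiniteKernel Q] :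
    IsBoundedlyContinuous (weightedOp V Q) := by
  intro f g C hC hf x
  refine Tendsto.const_mul _ (tendsto_integral_of_dominated_convergence (fun _ => C)
    (fun n => (f n).measurable_normalizedEval.aestronglyMeasurable) (integrable_const C)
    (fun n => Eventually.of_forall fun y => (norm_normalizedEval_apply_le y (f n)).trans (hC n))
    (Eventually.of_forall fun y => tendsto_normalizedEval (hf y)))

/-- A kernel with uniformly bounded densities with respect to a finite measure maps bounded
sequences to sequences having a pointwise convergent subsequence. -/
theorem exists_subseq_tendsto_weightedOp [MeasurableSpace.CountablyGenerated E]
    (S : Kernel E E) [IsFiniteKernel S] (m : Measure E) [IsFiniteMeasure m]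
    (hS : ∀ x, S x ≪ m) (f : ℕ → Linfty V) (hf : ∀ n, ‖f n‖ ≤ 1) :
    ∃ (g : Linfty V) (s : ℕ → ℕ), StrictMono s ∧
      ∀ x, Tendsto (fun n => weightedOp V S (f (s n)) x) atTop (nhds (g x)) := by
  -- `f n / V` acts on `L¹(m)` by integration
  have hint : ∀ n (h : Lp ℂ 1 m), Integrable (fun y => normalizedEval V y (f n) * h y) m :=
    fun n h => (L1.integrable_coeFn h).bdd_mul (c := 1)
      (f n).measurable_normalizedEval.aestronglyMeasurable
      (Eventually.of_forall fun y => (norm_normalizedEval_apply_le y (f n)).trans (hf n))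
  have hnorm : ∀ n (h : Lp ℂ 1 m), ‖∫ y, normalizedEval V y (f n) * h y ∂m‖ ≤ 1 * ‖h‖ := by
    intro n h
    rw [one_mul, L1.norm_eq_integral_norm]
    refine norm_integral_le_of_norm_le (L1.integrable_coeFn h).norm
      (Eventually.of_forall fun y => ?_)
    rw [norm_mul]
    exact mul_le_of_le_one_left (norm_nonneg _)
      ((norm_normalizedEval_apply_le y (f n)).trans (hf n))
  let Ψ : ℕ → Lp ℂ 1 m →L[ℂ] ℂ := fun n => LinearMap.mkContinuous
    { toFun := fun h => ∫ y, normalizedEval V y (f n) * h y ∂m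
      map_add' := fun h k => by
        rw [← integral_add (hint n h) (hint n k)]
        refine integral_congr_ae ?_
        filter_upwards [Lp.coeFn_add h k] with y hy
        rw [hy, Pi.add_apply, mul_add]
      map_smul' := fun c h => by
        rw [RingHom.id_apply, smul_eq_mul, ← integral_const_mul]
        refine integral_congr_ae ?_
        filter_upwards [Lp.coeFn_smul c h] with y hy
        rw [hy, Pi.smul_apply, smul_eq_mul, mul_left_comm] } 1 (hnorm n)
  have hΨ : ∀ n h, Ψ n h = ∫ y, normalizedEval V y (f n) * h y ∂m := fun _ _ => rfl
  have hΨ1 : ∀ n, ‖Ψ n‖ ≤ 1 := fun n => LinearMap.mkContinuous_norm_le _ zero_le_one _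
  have : Fact ((1 : ℝ≥0∞) ≠ ∞) := ⟨ENNReal.one_ne_top⟩
  obtain ⟨Φ, -, s, hs, hΦ⟩ := WeakDual.isSeqCompact_closedBall ℂ (Lp ℂ 1 m) 0 1
    (x := fun n => StrongDual.toWeakDual (Ψ n)) (fun n => by simpa using hΨ1 n)
  have hlim : ∀ h : Lp ℂ 1 m, Tendsto (fun n => Ψ (s n) h) atTop (nhds (Φ h)) := fun h =>
    ((WeakDual.eval_continuous h).tendsto Φ).comp hΦ
  -- the density of `S x` turns this into convergence of the integrals against `S x`
  have hdens : ∀ x, ∃ h : Lp ℂ 1 m, ∀ n, Ψ n h = ∫ y, normalizedEval V y (f n) ∂(S x) := by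
    intro x
    have hi : Integrable (fun y => (((S x).rnDeriv m y).toReal : ℂ)) m :=
      Measure.integrable_toReal_rnDeriv.ofReal
    refine ⟨hi.toL1 _, fun n => ?_⟩
    rw [hΨ, ← integral_rnDeriv_smul (hS x)]
    refine integral_congr_ae ?_
    filter_upwards [hi.coeFn_toL1] with y hy
    rw [hy, Complex.real_smul, mul_comm]
  choose h hh using hdens
  have hconv : ∀ x, Tendsto (fun n => weightedOp V S (f (s n)) x) atTop
      (nhds (V x * Φ (h x))) := by
    intro x
    refine Tendsto.const_mul _ ?_
    simpa only [hh] using hlim (h x)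
  refine ⟨ofBound (fun x => V x * Φ (h x))
    (measurable_of_tendsto_metrizable (fun n => (weightedOp V S (f (s n))).measurable)
      (tendsto_pi_nhds.2 hconv)) ‖weightedOp V S‖ fun x => ?_, s, hs, hconv⟩
  refine le_of_tendsto (hconv x).norm (Eventually.of_forall fun n => ?_)
  refine (norm_apply_le _ x).trans (mul_le_mul_of_nonneg_right ?_ (V.pos x).le)
  exact ((weightedOp V S).le_opNorm _).trans (mul_le_of_le_one_right (norm_nonneg _) (hf _))

/-- For a kernel dominated by a finite measure, pointwise convergence of a bounded sequence is
improved to norm convergence. -/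
theorem tendsto_weightedOp_of_le_smul (S : Kernel E E) [IsFiniteKernel S] (m : Measure E)
    [IsFiniteMeasure m] (M : ℝ≥0) (hS : ∀ x, S x ≤ M • m) {f : ℕ → Linfty V} {g : Linfty V}
    {C : ℝ} (hC : ∀ n, ‖f n‖ ≤ C)
    (hf : ∀ x, Tendsto (fun n => f n x) atTop (nhds (g x))) :
    Tendsto (fun n => weightedOp V S (f n)) atTop (nhds (weightedOp V S g)) := by
  have hlim : Tendsto (fun n => M * ∫ y, ‖normalizedEval V y (f n - g)‖ ∂m) atTop (nhds 0) := by
    have h0 : Tendsto (fun n => ∫ y, ‖normalizedEval V y (f n - g)‖ ∂m) atTop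
        (nhds (∫ _, (0 : ℝ) ∂m)) := by
      refine tendsto_integral_of_dominated_convergence (fun _ => C + ‖g‖)
        (fun n => (f n - g).measurable_normalizedEval.norm.aestronglyMeasurable)
        (integrable_const _) (fun n => Eventually.of_forall fun y => ?_)
        (Eventually.of_forall fun y => ?_)
      · rw [norm_norm]
        exact (norm_normalizedEval_apply_le y _).trans ((norm_sub_le _ _).trans
          (add_le_add (hC n) le_rfl))
      · simp only [map_sub]
        exact tendsto_iff_norm_sub_tendsto_zero.1 (tendsto_normalizedEval (hf y))
    simpa using h0.const_mul (M : ℝ)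
  refine tendsto_iff_norm_sub_tendsto_zero.2
    (squeeze_zero (fun _ => norm_nonneg _) (fun n => ?_) hlim)
  rw [← map_sub]
  refine norm_weightedOp_apply_le S
    (mul_nonneg M.coe_nonneg (integral_nonneg fun _ => norm_nonneg _)) fun x => ?_
  refine (norm_integral_le_integral_norm _).trans ?_
  refine (integral_mono_measure (hS x) (Eventually.of_forall fun _ => norm_nonneg _)
    ((f n - g).integrable_normalizedEval _).norm).trans ?_
  rw [integral_smul_nnreal_measure]
  rfl

/-- For a kernel dominated by a multiple of a finite measure, the products `S U S` with `U`
boundedly continuous are compact: the first factor `S` provides a pointwise convergent subsequence,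
and the last one makes the convergence uniform. -/
theorem isCompactOperator_weightedOp_mul [MeasurableSpace.CountablyGenerated E]
    (S : Kernel E E) [IsFiniteKernel S] (m : Measure E) [IsFiniteMeasure m] (M : ℝ≥0)
    (hS : ∀ x, S x ≤ M • m) {U : Linfty V →L[ℂ] Linfty V} (hU : IsBoundedlyContinuous U) :
    IsCompactOperator (weightedOp V S * U * weightedOp V S) := by
  refine isCompactOperator_of_exists_subseq_tendsto _ fun f hf => ?_
  have hac : ∀ x, S x ≪ m := fun x =>
    (Measure.absolutelyContinuous_of_le (hS x)).trans (Measure.smul_absolutelyContinuous)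
  obtain ⟨g, s, hs, hg⟩ := exists_subseq_tendsto_weightedOp (V := V) S m hac f hf
  have hb : ∀ n, ‖weightedOp V S (f (s n))‖ ≤ ‖weightedOp V S‖ := fun n =>
    ((weightedOp V S).le_opNorm _).trans (mul_le_of_le_one_right (norm_nonneg _) (hf _))
  refine ⟨weightedOp V S (U g), s, hs, ?_⟩
  exact tendsto_weightedOp_of_le_smul S m M hS (f := fun n => U (weightedOp V S (f (s n))))
    (C := ‖U‖ * ‖weightedOp V S‖)
    (fun n => (U.le_opNorm _).trans (mul_le_mul_of_nonneg_left (hb n) (norm_nonneg U)))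
    (hU _ g _ hb hg)
end

/-! ### The normalized kernel and its truncation -/

section
variable {E : Type*} [MeasurableSpace E] {V : Weight E} {P : Kernel E E}

open Linfty

/-- The kernel `V(x)⁻¹ P(x, dy) V(y)`, to which `P` is conjugate by multiplication with `V`. -/
noncomputable def normalizedKernel (V : Weight E) (P : Kernel E E) : Kernel E E where
  toFun x := (P x).withDensity fun y => ENNReal.ofReal (V y) / ENNReal.ofReal (V x)
  measurable' := by
    refine Measure.measurable_of_measurable_coe _ fun s hs => ?_
    have h : ∀ x, (P x).withDensity (fun y => ENNReal.ofReal (V y) / ENNReal.ofReal (V x)) s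
        = (∫⁻ y, s.indicator (fun y => ENNReal.ofReal (V y)) y ∂(P x)) / ENNReal.ofReal (V x) := by
      intro x
      rw [withDensity_apply _ hs, lintegral_indicator hs]
      simp only [div_eq_mul_inv]
      exact lintegral_mul_const _ V.measurable.ennreal_ofReal
    simp only [h]
    exact (V.measurable.ennreal_ofReal.indicator hs).lintegral_kernel.div
      V.measurable.ennreal_ofReal

theorem normalizedKernel_apply (x : E) : normalizedKernel V P x =
    (P x).withDensity fun y => ENNReal.ofReal (V y) / ENNReal.ofReal (V x) := rfl

theorem IsKernelInto.isFiniteKernel_normalizedKernel (hP : IsKernelInto V P) :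
    IsFiniteKernel (normalizedKernel V P) := by
  obtain ⟨C, hC⟩ := hP
  refine ⟨C, ENNReal.coe_lt_top, fun x => ?_⟩
  rw [normalizedKernel_apply, withDensity_apply _ MeasurableSet.univ, setLIntegral_univ]
  simp only [div_eq_mul_inv]
  rw [lintegral_mul_const _ V.measurable.ennreal_ofReal, ← div_eq_mul_inv,
    ENNReal.div_le_iff (ENNReal.ofReal_pos.2 (V.pos x)).ne' ENNReal.ofReal_ne_top]
  exact hC x

theorem kernelOp_apply_eq_normalizedKernel (hP : IsKernelInto V P) (f : Linfty V) (x : E) :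
    kernelOp V P hP f x = V x * ∫ y, normalizedEval V y f ∂(normalizedKernel V P x) := by
  have hVx := V.pos x
  have e : ∀ y, ENNReal.ofReal (V y) / ENNReal.ofReal (V x) = ENNReal.ofReal (V y / V x) :=
    fun y => (ENNReal.ofReal_div_of_pos hVx).symm
  have hm : Measurable fun y => ENNReal.ofReal (V y) / ENNReal.ofReal (V x) :=
    V.measurable.ennreal_ofReal.div_const _
  rw [normalizedKernel_apply, integral_withDensity_eq_integral_toReal_smul hm
    (Eventually.of_forall fun y => by rw [e]; exact ENNReal.ofReal_lt_top), ← integral_const_mul]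
  refine integral_congr_ae (Eventually.of_forall fun y => ?_)
  have hx : (V x : ℂ) ≠ 0 := by exact_mod_cast hVx.ne'
  have hy : (V y : ℂ) ≠ 0 := by exact_mod_cast (V.pos y).ne'
  simp only [e, ENNReal.toReal_ofReal (div_nonneg (V.pos y).le hVx.le), Complex.real_smul,
    normalizedEval_apply, Complex.ofReal_div]
  field_simp

open Classical in
/-- The function `V 1_s` for measurable `s`; it is set to `0` if `s` is not measurable. -/
noncomputable def weightIndicator (V : Weight E) (s : Set E) : Linfty V :=
  if hs : MeasurableSet s then
    ofBound (s.indicator fun x => (V x : ℂ))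
      ((Complex.measurable_ofReal.comp V.measurable).indicator hs) 1 fun x => by
        rw [one_mul]
        refine (norm_indicator_le_norm_self _ _).trans ?_
        rw [Complex.norm_real, Real.norm_of_nonneg (V.pos x).le]
  else 0

theorem weightIndicator_apply {s : Set E} (hs : MeasurableSet s) (x : E) :
    weightIndicator V s x = s.indicator (fun x => (V x : ℂ)) x := by
  rw [weightIndicator, dif_pos hs]
  rfl

theorem isNonneg_weightIndicator {s : Set E} (hs : MeasurableSet s) :
    (weightIndicator V s).IsNonneg := fun x => by
  rw [weightIndicator_apply hs]
  exact Set.indicator_nonneg (fun y _ => by exact_mod_cast (V.pos y).le) x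

theorem norm_weightIndicator_le {s : Set E} (hs : MeasurableSet s) :
    ‖weightIndicator V s‖ ≤ 1 :=
  norm_le_of zero_le_one fun x => by
    rw [weightIndicator_apply hs, one_mul]
    refine (norm_indicator_le_norm_self _ _).trans ?_
    rw [Complex.norm_real, Real.norm_of_nonneg (V.pos x).le]

theorem weightIndicator_union {s t : Set E} (hs : MeasurableSet s) (ht : MeasurableSet t)
    (h : Disjoint s t) :
    weightIndicator V (s ∪ t) = weightIndicator V s + weightIndicator V t := by
  ext x
  rw [Linfty.add_apply, weightIndicator_apply hs, weightIndicator_apply ht,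
    weightIndicator_apply (hs.union ht), Set.indicator_union_of_disjoint h]

theorem integral_normalizedEval_weightIndicator {s : Set E} (hs : MeasurableSet s)
    (μ : Measure E) : ∫ y, normalizedEval V y (weightIndicator V s) ∂μ = (μ.real s : ℂ) := by
  have h : ∀ y, normalizedEval V y (weightIndicator V s) = s.indicator (fun _ => (1 : ℂ)) y := by
    intro y
    rw [normalizedEval_apply, weightIndicator_apply hs]
    by_cases hy : y ∈ s
    · rw [Set.indicator_of_mem hy, Set.indicator_of_mem hy, div_self]
      exact_mod_cast (V.pos y).ne'
    · rw [Set.indicator_of_notMem hy, Set.indicator_of_notMem hy, zero_div]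
  simp only [h]
  rw [integral_indicator hs]
  simp

/-- If the positive operator `P` is dominated by a positive compact operator up to `θ V ‖·‖`, then
the normalized kernel is dominated by a finite measure, uniformly in `x`, up to mass `θ + ε`.
The measure is the sum of the countably additive parts of finitely many functionals `f ↦ K f (p)`.
-/
theorem exists_measure_normalizedKernel_le [Nonempty E] (hP : IsKernelInto V P)
    {K : Linfty V →L[ℂ] Linfty V} (hKc : IsCompactOperator K) (hKpos : IsPositiveOperator K)
    {θ ε : ℝ≥0} (hε : 0 < ε)
    (hK : ∀ f : Linfty V, f.IsNonneg → ∀ x,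
      (kernelOp V P hP f x).re ≤ (K f x).re + θ * V x * ‖f‖) :
    ∃ m : Measure E, IsFiniteMeasure m ∧
      ∀ x s, MeasurableSet s → normalizedKernel V P x s ≤ m s + (θ + ε : ℝ≥0) := by
  have := hP.isFiniteKernel_normalizedKernel
  obtain ⟨N, p, i, -, hi⟩ := exists_measurable_finite_approx hKc (V := V)
    (show (0 : ℝ) < ε by exact_mod_cast hε)
  have hnn : ∀ (x : E) (s : Set E), MeasurableSet s →
      0 ≤ (normalizedEval V x (K (weightIndicator V s))).re := by
    intro x s hs
    rw [normalizedEval_apply, Complex.div_ofReal_re]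
    exact div_nonneg ((hKpos _ (isNonneg_weightIndicator hs)).re_nonneg x) (V.pos x).le
  let φ : Fin N → Set E → ℝ≥0∞ := fun k s =>
    ENNReal.ofReal (normalizedEval V (p k) (K (weightIndicator V s))).re
  have hφ0 : ∀ k, φ k ∅ = 0 := by
    intro k
    have h0 : weightIndicator V (∅ : Set E) = 0 := by
      ext x
      rw [weightIndicator_apply MeasurableSet.empty, Set.indicator_empty, Linfty.zero_apply]
    simp [φ, h0]
  have hφ : ∀ k s t, MeasurableSet s → MeasurableSet t → Disjoint s t →
      φ k (s ∪ t) = φ k s + φ k t := by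
    intro k s t hs ht hst
    simp only [φ]
    rw [weightIndicator_union hs ht hst, map_add, map_add, Complex.add_re,
      ENNReal.ofReal_add (hnn _ _ hs) (hnn _ _ ht)]
  choose ν hν1 hν2 using fun k => exists_measure_le_of_additive (φ k) (hφ0 k) (hφ k)
  have hνfin : ∀ k, IsFiniteMeasure (ν k) := fun k =>
    ⟨(hν1 k _ MeasurableSet.univ).trans_lt ENNReal.ofReal_lt_top⟩
  refine ⟨∑ k, ν k, inferInstance, fun x s hs => ?_⟩
  have key : ∀ t, MeasurableSet t →
      normalizedKernel V P x t ≤ φ (i x) t + (θ + ε : ℝ≥0) := by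
    intro t ht
    have h1 := hK _ (isNonneg_weightIndicator ht) x
    rw [kernelOp_apply_eq_normalizedKernel, integral_normalizedEval_weightIndicator ht,
      ← Complex.ofReal_mul, Complex.ofReal_re, ← mul_normalizedEval x (K _),
      Complex.re_ofReal_mul] at h1
    have h2 : (normalizedKernel V P x).real t
        ≤ (normalizedEval V x (K (weightIndicator V t))).re + θ := by
      refine le_of_mul_le_mul_left (h1.trans ?_) (V.pos x)
      have := mul_le_mul_of_nonneg_left (norm_weightIndicator_le (V := V) ht)
        (mul_nonneg θ.coe_nonneg (V.pos x).le)
      linarith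
    have h3 : (normalizedEval V x (K (weightIndicator V t))).re
        ≤ (normalizedEval V (p (i x)) (K (weightIndicator V t))).re + ε := by
      have h := ((normalizedEval V x).comp K
        - (normalizedEval V (p (i x))).comp K).le_of_opNorm_le_of_le (hi x)
        (norm_weightIndicator_le (V := V) ht)
      have h' := (Complex.re_le_norm _).trans h
      rw [_root_.sub_apply, Complex.sub_re] at h'
      simp only [ContinuousLinearMap.comp_apply] at h'
      linarith
    rw [← ENNReal.ofReal_toReal (measure_ne_top (normalizedKernel V P x) t),
      ← ENNReal.ofReal_coe_nnreal, ← ENNReal.ofReal_add (hnn _ _ ht) (NNReal.coe_nonneg _)]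
    refine ENNReal.ofReal_le_ofReal ?_
    rw [NNReal.coe_add]
    exact h2.trans (by linarith)
  refine (hν2 (i x) _ _ key s hs).trans (add_le_add ?_ le_rfl)
  rw [Measure.coe_finsetSum, Finset.sum_apply]
  exact Finset.single_le_sum (f := fun k => ν k s) (fun _ _ => zero_le) (Finset.mem_univ (i x))

/-- The kernel obtained by restricting each `Q x` to the section `{y | (x, y) ∈ D}`. -/
noncomputable def sectionRestrict (Q : Kernel E E) [IsFiniteKernel Q] {D : Set (E × E)}
    (hD : MeasurableSet D) : Kernel E E where
  toFun x := (Q x).restrict (Prod.mk x ⁻¹' D)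
  measurable' := by
    refine Measure.measurable_of_measurable_coe _ fun s hs => ?_
    have h : ∀ x, (Q x).restrict (Prod.mk x ⁻¹' D) s
        = Q x (Prod.mk x ⁻¹' (D ∩ Prod.snd ⁻¹' s)) := by
      intro x
      rw [Measure.restrict_apply hs, Set.inter_comm]
      rfl
    simp only [h]
    exact Kernel.measurable_kernel_prodMk_left (hD.inter (measurable_snd hs))

theorem sectionRestrict_apply (Q : Kernel E E) [IsFiniteKernel Q] {D : Set (E × E)}
    (hD : MeasurableSet D) (x : E) :
    sectionRestrict Q hD x = (Q x).restrict (Prod.mk x ⁻¹' D) := rfl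

instance (Q : Kernel E E) [IsFiniteKernel Q] {D : Set (E × E)} (hD : MeasurableSet D) :
    IsFiniteKernel (sectionRestrict Q hD) :=
  ⟨Q.bound, Kernel.bound_lt_top Q, fun x =>
    (Measure.restrict_apply_le _ _).trans (Q.measure_le_bound x _)⟩

/-- A jointly measurable truncation of the density of a finite kernel with respect to a finite
measure `m`: outside sections of small `m`-measure, the kernel is dominated by a multiple of `m`.
-/
theorem exists_section_le_smul [MeasurableSpace.CountablyGenerated E] (Q : Kernel E E)
    [IsFiniteKernel Q] (m : Measure E) [IsFiniteMeasure m] {δ : ℝ≥0} (hδ : 0 < δ) :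
    ∃ (D : Set (E × E)) (hD : MeasurableSet D) (M : ℝ≥0),
      (∀ x, sectionRestrict Q hD x ≤ M • m) ∧ ∀ x, m (Prod.mk x ⁻¹' Dᶜ) ≤ δ := by
  let η : Kernel E E := Kernel.const E m
  have hη : ∀ x, η x = m := fun x => Kernel.const_apply m x
  obtain ⟨C, hC⟩ : ∃ C : ℝ≥0, Q.bound = C := ⟨_, (ENNReal.coe_toNNReal Q.bound_ne_top).symm⟩
  -- by Markov's inequality, the density exceeds `M ≥ C / δ` on a set of measure at most `δ`
  let M : ℝ≥0 := C / δ + 1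
  let D : Set (E × E) := (Kernel.mutuallySingularSet Q η)ᶜ ∩ {p | Q.rnDeriv η p.1 p.2 ≤ M}
  have hD : MeasurableSet D := (Kernel.measurableSet_mutuallySingularSet Q η).compl.inter
    (measurableSet_le (Kernel.measurable_rnDeriv Q η) measurable_const)
  have hsplit : ∀ x s, Q x s = (∫⁻ y in s, Q.rnDeriv η x y ∂m) + Q.singularPart η x s := by
    intro x s
    conv_lhs => rw [← Kernel.rnDeriv_add_singularPart Q η]
    rw [FunLike.coe_add, Pi.add_apply, Measure.coe_add, Pi.add_apply,
      Kernel.withDensity_apply' _ (Kernel.measurable_rnDeriv Q η), hη]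
  refine ⟨D, hD, M, fun x => Measure.le_intro fun s hs _ => ?_, fun x => ?_⟩
  · have hDx : MeasurableSet (Prod.mk x ⁻¹' D) := measurable_prodMk_left hD
    rw [sectionRestrict_apply, Measure.restrict_apply hs, hsplit,
      Kernel.singularPart_of_subset_compl_mutuallySingularSetSlice (fun y hy => hy.2.1), add_zero]
    calc ∫⁻ y in s ∩ Prod.mk x ⁻¹' D, Q.rnDeriv η x y ∂m
        ≤ ∫⁻ _ in s ∩ Prod.mk x ⁻¹' D, M ∂m :=
          setLIntegral_mono' (hs.inter hDx) fun y hy => hy.2.2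
      _ = M * m (s ∩ Prod.mk x ⁻¹' D) := setLIntegral_const _ _
      _ ≤ M * m s := by gcongr; exact Set.inter_subset_left
      _ = (M • m) s := rfl
  · have hsub : Prod.mk x ⁻¹' Dᶜ ⊆ Kernel.mutuallySingularSetSlice Q η x ∪
        {y | (M : ℝ≥0∞) ≤ Q.rnDeriv η x y} := by
      intro y hy
      by_contra! h
      rw [Set.mem_union, not_or] at h
      have hlt : Q.rnDeriv η x y < M := not_le.1 h.2
      exact hy ⟨h.1, hlt.le⟩
    refine (measure_mono hsub).trans ((measure_union_le _ _).trans ?_)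
    have h0 : m (Kernel.mutuallySingularSetSlice Q η x) = 0 := by
      rw [← hη x]
      exact Kernel.measure_mutuallySingularSetSlice Q η x
    rw [h0, zero_add]
    have hM : (M : ℝ≥0∞) ≠ 0 := by positivity
    refine (meas_ge_le_lintegral_div (Kernel.measurable_rnDeriv_right Q η x).aemeasurable hM
      ENNReal.coe_ne_top).trans ?_
    have h1 : ∫⁻ y, Q.rnDeriv η x y ∂m ≤ C := by
      have h := hsplit x Set.univ
      rw [setLIntegral_univ] at h
      rw [← hC]
      exact (le_of_le_of_eq le_self_add h.symm).trans (Q.measure_le_bound x _)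
    refine ENNReal.div_le_of_le_mul (h1.trans ?_)
    rw [← ENNReal.coe_mul, ENNReal.coe_le_coe]
    calc C = δ * (C / δ) := by field_simp
      _ ≤ δ * M := by gcongr; exact le_self_add

/-- Domination of `P` by a positive compact operator up to `θ V ‖·‖` bounds the essential spectral
radius by `θ`: the truncated density gives the part `S` with compact products `S R^k S`, and the
rest `R` has norm at most `θ + ε`. -/
theorem essentialSpectralRadius_kernelOp_le [Nonempty E] [MeasurableSpace.CountablyGenerated E]
    (hP : IsKernelInto V P) {K : Linfty V →L[ℂ] Linfty V} (hKc : IsCompactOperator K)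
    (hKpos : IsPositiveOperator K) {θ : ℝ≥0}
    (hK : ∀ f : Linfty V, f.IsNonneg → ∀ x,
      (kernelOp V P hP f x).re ≤ (K f x).re + θ * V x * ‖f‖) :
    essentialSpectralRadius (kernelOp V P hP) ≤ θ := by
  refine ENNReal.le_of_forall_pos_le_add fun ε hε _ => ?_
  have := hP.isFiniteKernel_normalizedKernel
  set Q := normalizedKernel V P with hQ
  obtain ⟨m, hm, hle⟩ := exists_measure_normalizedKernel_le hP hKc hKpos (half_pos hε) hK
  obtain ⟨D, hD, M, hS, hR⟩ := exists_section_le_smul Q m (half_pos hε)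
  have hsum : kernelOp V P hP
      = weightedOp V (sectionRestrict Q hD) + weightedOp V (sectionRestrict Q hD.compl) := by
    ext f x
    rw [_root_.add_apply, Linfty.add_apply, weightedOp_apply, weightedOp_apply,
      kernelOp_apply_eq_normalizedKernel, ← mul_add,
      ← integral_add_measure (f.integrable_normalizedEval _) (f.integrable_normalizedEval _),
      sectionRestrict_apply, sectionRestrict_apply, Set.preimage_compl,
      Measure.restrict_add_restrict_compl (measurable_prodMk_left hD)]
  have hnorm : ‖weightedOp V (sectionRestrict Q hD.compl)‖ ≤ (θ + ε : ℝ≥0) := by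
    refine norm_weightedOp_le _ (NNReal.coe_nonneg _) fun x => ?_
    refine ENNReal.toReal_le_of_le_ofReal (NNReal.coe_nonneg _) ?_
    rw [ENNReal.ofReal_coe_nnreal, sectionRestrict_apply, Measure.restrict_apply_univ]
    refine (hle x _ (measurable_prodMk_left hD.compl)).trans ?_
    refine (add_le_add (hR x) le_rfl).trans ?_
    rw [← ENNReal.coe_add, ENNReal.coe_le_coe, add_left_comm, add_halves]
  rw [hsum, ← ENNReal.coe_add]
  exact essentialSpectralRadius_add_le _ _ (by positivity) hnorm fun k =>
    isCompactOperator_weightedOp_mul _ m M hS ((isBoundedlyContinuous_weightedOp _).pow k)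

end

theorem mainTheorem7 {E : Type*} [MeasurableSpace E] [MeasurableSpace.CountablyGenerated E]
    (V : Weight E) (P : Kernel E E) (hP : IsKernelInto V P)
    (E_K : Set E) (hE_K : MeasurableSet E_K)
    (A : ℝ) (hA : 0 < A) (θ₄ θ₂ : ℝ≥0)
    (hθ₄ : (θ₄ : ℝ≥0∞) < spectralRadius ℂ (kernelOp V P hP))
    (hθ₂ : (θ₂ : ℝ≥0∞) = tailBound V P E_K A + θ₄)
    (hθ₂_lt : (θ₂ : ℝ≥0∞) < spectralRadius ℂ (kernelOp V P hP))
    (K_A : Linfty (V.restrict (V.sublevel A)) →L[ℂ] Linfty (V.restrict E_K))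
    (hK_A : IsCompactOperator K_A)
    (hdom : SublevelDomination V P hP E_K A θ₄ K_A) :
    (∃ θ : ℝ≥0, LocalDomination V P hP E_K θ) ∧
    (0 < θ₂ → LocalDomination V P hP E_K θ₂) ∧
    ∀ θ₁ : ℝ≥0, GlobalLyapunov V P hP E_K θ₁ →
      IsQuasiCompact (kernelOp V P hP) ∧
        essentialSpectralRadius (kernelOp V P hP) ≤ max (θ₁ : ℝ≥0∞) (θ₂ : ℝ≥0∞) := by
  rcases isEmpty_or_nonempty E with hE | hE
  · -- on the zero space the spectral radius vanishes
    have : Subsingleton (Linfty V) := ⟨fun f g => Linfty.ext fun x => hE.elim x⟩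
    have : Subsingleton (Linfty V →L[ℂ] Linfty V) :=
      ⟨fun S T => ContinuousLinearMap.ext fun f => Subsingleton.elim _ _⟩
    rw [spectrum.SpectralRadius.of_subsingleton] at hθ₂_lt
    exact absurd hθ₂_lt not_lt_zero
  have hdomination : ∀ θ : ℝ≥0, 0 < θ → θ₂ ≤ θ →
      (θ : ℝ≥0∞) < spectralRadius ℂ (kernelOp V P hP) → LocalDomination V P hP E_K θ :=
    fun θ h0 hle hlt =>
      localDomination_of_sublevelDomination hP hE_K hθ₂ h0 hle hlt hK_A hdom
  refine ⟨?_, fun h0 => hdomination θ₂ h0 le_rfl hθ₂_lt, fun θ₁ h1 => ?_⟩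
  · obtain ⟨θ, hθ, hθr⟩ := ENNReal.lt_iff_exists_nnreal_btwn.1 hθ₂_lt
    have h : θ₂ < θ := by exact_mod_cast hθ
    exact ⟨θ, hdomination θ (pos_of_gt h) h.le hθr⟩
  · have hmax : ((max θ₁ θ₂ : ℝ≥0) : ℝ≥0∞) < spectralRadius ℂ (kernelOp V P hP) := by
      rw [ENNReal.coe_max]
      exact max_lt h1.2.1 hθ₂_lt
    -- the constant `θ₂` may vanish, which local domination does not allow; `max θ₁ θ₂` is positive
    have h2 := hdomination (max θ₁ θ₂) (lt_max_of_lt_left h1.1) (le_max_right _ _) hmax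
    obtain ⟨K, hKc, hKpos, hK⟩ := exists_global_domination h1 h2
    rw [max_eq_right (le_max_left θ₁ θ₂)] at hK
    have hess := essentialSpectralRadius_kernelOp_le hP hKc hKpos hK
    refine ⟨hess.trans_lt hmax, ?_⟩
    rwa [ENNReal.coe_max] at hess
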